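/- **Setting.** Terms are variables (from an infinite supply) or constants; facts and (Boolean conjunctive) queries are finite sets of atoms, read as existentially closed conjunctions. For queries $A,B$, $A\ge B$ ("$A$ is more general than $B$") means that there is a homomorphism from $A$ to $B$, i.e. a substitution $h$ with $h(A)\subseteq B$. An existential rule $R$ is $\forall\vec x\forall\vec y\,(B[\vec x,\vec y]\to\exists\vec z\,H[\vec y,\vec z])$ with body $B$ and head $H$ finite conjunctions of atoms; $\vec y$ is its frontier, $\vec z$ are its existential variables. $\models$ is first-order logical consequence. **Rewriting operators.** A rewriting operator $\mathrm{rew}$ maps a query $Q$ and a set of rules $\mathcal R$ to a set $\mathrm{rew}(Q,\mathcal R)$ of queries; $W_\infty(Q,\mathcal R)$ is the set of queries obtained from $Q$ by finitely many ($\ge 0$) successive applications of it. It is *sound* if for all $\mathcal R$, $Q$, $Q'\in\mathrm{rew}(Q,\mathcal R)$ and all facts $F$, $F\models Q'$ implies $F,\mathcal R\models Q$; *complete* if for all $\mathcal R,Q,F$ with $F,\mathcal R\models Q$ there is $Q'\in W_\infty(Q,\mathcal R)$ with $F\models Q'$; *prunable* if for all $\mathcal R$ and all $Q_1,Q_2,Q_2'$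 with $Q_1\ge Q_2$, $Q_2'\in\mathrm{rew}(Q_2,\mathcal R)$ and $Q_1\not\ge Q_2'$, there is $Q_1'\in\mathrm{rew}(Q_1,\mathcal R)$ with $Q_1'\ge Q_2'$. **Piece-unifiers.** Let $Q$ and $R$ have disjoint variables. A piece-unifier of $Q$ with $R$ is a triple $\mu=(Q',H',P)$ where $\emptyset\ne Q'\subseteq Q$, $H'\subseteq\mathrm{head}(R)$ and $P$ is a partition of $\mathrm{terms}(Q')\cup\mathrm{terms}(H')$ such that (1) $P$ is admissible: no class contains two constants; (2) if a class contains an existential variable of $R$, all its other terms are variables of $Q'$ that do not occur in $Q\setminus Q'$; (3) $u(H')=u(Q')$, where $u$ is a substitution associated with $P$, i.e. it sends every element of a class to one selected element of that class, a constant if there is one, and fixes the variables outside $P$. Its rewriting is $\beta(Q,R,\mu)=u(\mathrm{body}(R))\cup u(Q\setminus Q')$. The cutpoints of $\mu$ are the variables of $Q'$ not in the same class as an existential variable of $R$. $\mu$ is *single-piece* if $Q'$ is a piece of $Q$, i.e. a minimal non-empty subset of $Q$ that contains, with any atom $a$, all atoms of $Q$ sharing with $a$ a variable that is not a cutpoint.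 $\mu$ is *most general* if there is no piece-unifier $(Q',H',P_1)$ of $Q$ with $R$ with $P_1$ strictly finer than $P$. **Aggregation.** Let $k\ge1$ and let $\mu_i=(Q_i',H_i',P_i)$ be piece-unifiers of $Q$ with rules $R_i$ $(1\le i\le k)$, the $R_i$ having pairwise disjoint variables. They are *compatible* if the $Q_i'$ are pairwise disjoint and the join of $P_1,\dots,P_k$ (obtained by merging non-disjoint classes until stability) is admissible. The *aggregated unifier* is then $\mu=(\bigcup_i Q_i',\bigcup_i H_i',\text{join of the }P_i)$; it is single-piece (most general) if all the $\mu_i$ are. The aggregation $R_1\diamond\cdots\diamond R_k$ is the rule whose body (head) is the conjunction of the bodies (heads) of the $R_i$. The *single-piece aggregator* is the rewriting operator that outputs, for $Q$ and $\mathcal R$, all the queries $\beta(Q,R_1\diamond\cdots\diamond R_k,\mu)$, where $\mu$ is a most general single-piece aggregated unifier of $Q$ with $R_1,\dots,R_k$, and $R_1,\dots,R_k$ are copies (injective variable renamings) of the same rule $R\in\mathcal R$. **Theorem.** The single-piece aggregator is sound, complete and prunable. Moreover: (a) for every compatible family of piece-unifiers of a query $Q$ with rules $R_1,\dots,R_k$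 ($k\ge 1$), the aggregated unifier is a piece-unifier of $Q$ with $R_1\diamond\cdots\diamond R_k$; (b) for every piece-unifier $\mu$ of $Q$ with $R$ there is a most general single-piece aggregated unifier $\mu_\diamond$ of $Q$ with copies $R_1,\dots,R_k$ of $R$ such that $\beta(Q,R_1\diamond\cdots\diamond R_k,\mu_\diamond)\ge\beta(Q,R,\mu)$ (whatever associated substitutions are chosen). -/

import Mathlib

universe u

namespace ExRules

/-- Terms: variables or constants. -/
inductive Term (C V : Type u) : Type u
  | var (v : V) : Term C V
  | const (c : C) : Term C V

/-- Atoms `p(t₁, …, tₖ)`, where `k = ar p` is the arity of the predicate `p`. -/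
structure Atom {P : Type u} (ar : P → ℕ) (C V : Type u) : Type u where
  pred : P
  args : Fin (ar pred) → Term C V

noncomputable instance {P : Type u} (ar : P → ℕ) (C V : Type u) : DecidableEq (Atom ar C V) :=
  Classical.decEq _

/-- A finite set of atoms, seen as an existentially closed conjunction: facts and Boolean
conjunctive queries have this same form. -/
abbrev Query {P : Type u} (ar : P → ℕ) (C V : Type u) : Type u := Finset (Atom ar C V)

/-- An existential rule `body → head`; the quantifiers are determined by the variables. -/
structure Rule {P : Type u} (ar : P → ℕ) (C V : Type u) : Type u where
  body : Query ar C V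
  head : Query ar C V

section Formulas

variable {P C V : Type u} {ar : P → ℕ}

/-- The set of variables of a finite set of atoms. -/
def vars (A : Query ar C V) : Set V :=
  {v | ∃ a ∈ A, ∃ i, a.args i = Term.var v}

/-- The set of terms of a finite set of atoms. -/
def terms (A : Query ar C V) : Set (Term C V) :=
  {t | ∃ a ∈ A, ∃ i, a.args i = t}

/-- Variables of a rule. -/
def Rule.vars (R : Rule ar C V) : Set V := ExRules.vars R.body ∪ ExRules.vars R.head

/-- The frontier of a rule. -/
def Rule.frontier (R : Rule ar C V) : Set V := ExRules.vars R.body ∩ ExRules.vars R.head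

/-- The existential variables of a rule. -/
def Rule.exVars (R : Rule ar C V) : Set V := ExRules.vars R.head \ R.frontier

/-- Substitutions: they fix constants; a substitution of a set of variables is the identity
on all other variables. -/
abbrev Subst (C V : Type u) : Type u := V → Term C V

/-- Action of a substitution on terms. -/
def Subst.onTerm (s : Subst C V) : Term C V → Term C V
  | Term.var v => s v
  | Term.const c => Term.const c

/-- Action of a substitution on atoms. -/
def Subst.onAtom (s : Subst C V) (a : Atom ar C V) : Atom ar C V :=
  ⟨a.pred, fun i => s.onTerm (a.args i)⟩

/-- Action of a substitution on finite sets of atoms. -/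
noncomputable def Subst.onQuery (s : Subst C V) (A : Query ar C V) : Query ar C V :=
  A.image s.onAtom

/-- `A ≥ B`: `A` is more general than `B`, i.e. there is a homomorphism from `A` to `B`. -/
def MoreGeneral (A B : Query ar C V) : Prop :=
  ∃ h : Subst C V, h.onQuery A ⊆ B

/-- `R'` is a copy of `R`: it is obtained by an injective renaming of the variables of `R`. -/
def Rule.IsCopy (R R' : Rule ar C V) : Prop :=
  ∃ f : V → V, Set.InjOn f R.vars ∧
    R'.body = Subst.onQuery (fun v => Term.var (f v)) R.body ∧
    R'.head = Subst.onQuery (fun v => Term.var (f v)) R.head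

end Formulas

/-- First-order interpretations, with a non-empty domain. -/
structure Interp {P : Type u} (ar : P → ℕ) (C : Type u) : Type (u + 1) where
  D : Type u
  nonempty : Nonempty D
  const : C → D
  pred : (p : P) → (Fin (ar p) → D) → Prop

section Semantics

variable {P C V : Type u} {ar : P → ℕ}

/-- Value of a term under an assignment of the variables. -/
def Interp.val (M : Interp ar C) (α : V → M.D) : Term C V → M.D
  | Term.var v => α v
  | Term.const c => M.const c

/-- All the atoms of `A` hold in `M` under the assignment `α`. -/
def Interp.Holds (M : Interp ar C) (α : V → M.D) (A : Query ar C V) : Prop :=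
  ∀ a ∈ A, M.pred a.pred (fun i => M.val α (a.args i))

/-- `M` is a model of the existential closure of `A`. -/
def Interp.SatQuery (M : Interp ar C) (A : Query ar C V) : Prop :=
  ∃ α : V → M.D, M.Holds α A

/-- `M` is a model of the rule `R`: every assignment satisfying the body can be changed on the
existential variables so as to satisfy the head. -/
def Interp.SatRule (M : Interp ar C) (R : Rule ar C V) : Prop :=
  ∀ α : V → M.D, M.Holds α R.body →
    ∃ β : V → M.D, (∀ v, v ∉ R.exVars → β v = α v) ∧ M.Holds β R.head

/-- Logical consequence `F, 𝓡 ⊨ Q`. -/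
def Entails (F : Query ar C V) (𝓡 : Set (Rule ar C V)) (Q : Query ar C V) : Prop :=
  ∀ M : Interp ar C, M.SatQuery F → (∀ R ∈ 𝓡, M.SatRule R) → M.SatQuery Q

end Semantics

section Operators

variable {P C V : Type u} {ar : P → ℕ}

/-- A rewriting operator maps a query and a set of rules to a set of queries. -/
abbrev RewOp {P : Type u} (ar : P → ℕ) (C V : Type u) : Type u :=
  Query ar C V → Set (Rule ar C V) → Set (Query ar C V)

/-- The set of `k`-rewritings of `Q`; the only `0`-rewriting of `Q` is `Q`. -/
def RewOp.iter (rew : RewOp ar C V) (Q : Query ar C V) (𝓡 : Set (Rule ar C V)) :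
    ℕ → Set (Query ar C V)
  | 0 => {Q}
  | k + 1 => {Q' | ∃ Q'' ∈ RewOp.iter rew Q 𝓡 k, Q' ∈ rew Q'' 𝓡}

/-- `W_∞(Q, 𝓡)`: the set of all `k`-rewritings of `Q`, for all `k`. -/
def RewOp.saturation (rew : RewOp ar C V) (Q : Query ar C V) (𝓡 : Set (Rule ar C V)) :
    Set (Query ar C V) :=
  ⋃ k : ℕ, rew.iter Q 𝓡 k

def RewOp.Sound (rew : RewOp ar C V) : Prop :=
  ∀ (𝓡 : Set (Rule ar C V)) (Q Q' : Query ar C V), Q' ∈ rew Q 𝓡 →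
    ∀ F : Query ar C V, Entails F ∅ Q' → Entails F 𝓡 Q

def RewOp.Complete (rew : RewOp ar C V) : Prop :=
  ∀ (𝓡 : Set (Rule ar C V)) (Q F : Query ar C V), Entails F 𝓡 Q →
    ∃ Q' ∈ rew.saturation Q 𝓡, Entails F ∅ Q'

def RewOp.Prunable (rew : RewOp ar C V) : Prop :=
  ∀ (𝓡 : Set (Rule ar C V)) (Q₁ Q₂ Q₂' : Query ar C V), MoreGeneral Q₁ Q₂ →
    Q₂' ∈ rew Q₂ 𝓡 → ¬ MoreGeneral Q₁ Q₂' →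
    ∃ Q₁' ∈ rew Q₁ 𝓡, MoreGeneral Q₁' Q₂'

end Operators

/-- A partition of a set of terms, given by the relation "to be in the same class".
The partitioned set is `{t | rel t t}`. -/
structure TermPartition (C V : Type u) : Type u where
  rel : Term C V → Term C V → Prop
  symm : ∀ {s t}, rel s t → rel t s
  trans : ∀ {r s t}, rel r s → rel s t → rel r t

section Partitions

variable {C V : Type u}

/-- The partitioned set. -/
def TermPartition.support (p : TermPartition C V) : Set (Term C V) := {t | p.rel t t}

/-- `p` is finer than `q`: every class of `p` is included in a class of `q`. -/
def TermPartition.Finer (p q : TermPartition C V) : Prop :=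
  ∀ s t, p.rel s t → q.rel s t

/-- No class contains two (distinct) constants. -/
def TermPartition.Admissible (p : TermPartition C V) : Prop :=
  ∀ c d : C, p.rel (Term.const c) (Term.const d) → c = d

/-- The join of a family of partitions: non-disjoint classes are merged until stability. -/
def TermPartition.join {ι : Type} (p : ι → TermPartition C V) : TermPartition C V where
  rel := Relation.TransGen (fun s t => ∃ i, (p i).rel s t)
  symm := by
    intro s t h
    induction h with
    | single h => exact .single (h.imp fun i hi => (p i).symm hi)
    | tail _ h ih => exact .head (h.imp fun i hi => (p i).symm hi) ih
  trans := fun h h' => h.trans h'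

/-- `s` is a substitution associated with `p`: it sends each variable of the partitioned set to
an element selected in its class, the same for the whole class, and it is the identity on the
other variables. Since `s` fixes constants, the second clause gives priority to constants. -/
structure TermPartition.IsAssociated (p : TermPartition C V) (s : Subst C V) : Prop where
  mem_class : ∀ v, Term.var v ∈ p.support → p.rel (Term.var v) (s v)
  const_on_class : ∀ t t', p.rel t t' → s.onTerm t = s.onTerm t'
  eq_self : ∀ v, Term.var v ∉ p.support → s v = Term.var v

end Partitions

/-- A triple `(Q', H', P)`: a part of a query, a part of a rule head, a partition of terms. -/
structure Unifier {P : Type u} (ar : P → ℕ) (C V : Type u) : Type u where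
  query : Query ar C V
  head : Query ar C V
  part : TermPartition C V

section Unifiers

variable {P C V : Type u} {ar : P → ℕ}

/-- `μ` is a piece-unifier of `Q` with `R`, where `Q` and `R` have no common variable. -/
structure IsPieceUnifier (Q : Query ar C V) (R : Rule ar C V) (μ : Unifier ar C V) : Prop where
  disjoint_vars : Disjoint (vars Q) R.vars
  nonempty : μ.query.Nonempty
  query_subset : μ.query ⊆ Q
  head_subset : μ.head ⊆ R.head
  support_eq : μ.part.support = terms μ.query ∪ terms μ.head
  admissible : μ.part.Admissible
  /-- the terms that share a class with an existential variable, other than this variable,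
  are non-separating variables of `Q'` -/
  existential : ∀ y ∈ R.exVars, ∀ t, μ.part.rel (Term.var y) t → t ≠ Term.var y →
    ∃ x, t = Term.var x ∧ x ∈ vars μ.query ∧ x ∉ vars (Q \ μ.query)
  unifies : ∀ s : Subst C V, μ.part.IsAssociated s → s.onQuery μ.head = s.onQuery μ.query

/-- The cutpoints: the variables of `Q'` that are not unified with an existential variable. -/
def Unifier.cutpoints (μ : Unifier ar C V) (R : Rule ar C V) : Set V :=
  {x | x ∈ vars μ.query ∧ ∀ y ∈ R.exVars, ¬ μ.part.rel (Term.var x) (Term.var y)}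

/-- `B ⊆ A` is closed under sharing variables that are not in `T`. -/
def GlueClosed (A : Query ar C V) (T : Set V) (B : Query ar C V) : Prop :=
  ∀ a ∈ A, ∀ a' ∈ A, a ∈ B → ¬ (vars {a} ∩ vars {a'} ⊆ T) → a' ∈ B

/-- `B` is a piece of `A` according to `T`: a minimal non-empty glue-closed subset. -/
def IsPiece (A : Query ar C V) (T : Set V) (B : Query ar C V) : Prop :=
  Minimal (fun B => B ⊆ A ∧ B.Nonempty ∧ GlueClosed A T B) B

/-- `μ = (Q', H', P)` is a single-piece unifier: `Q'` is a single piece of `Q`. -/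
def IsSinglePieceUnifier (Q : Query ar C V) (R : Rule ar C V) (μ : Unifier ar C V) : Prop :=
  IsPieceUnifier Q R μ ∧ IsPiece Q (μ.cutpoints R) μ.query

/-- `μ = (Q', H', P)` is a most general piece-unifier: no piece-unifier on the same `Q'` and `H'`
is strictly more general, i.e. has a strictly finer partition. -/
def IsMostGeneral (Q : Query ar C V) (R : Rule ar C V) (μ : Unifier ar C V) : Prop :=
  IsPieceUnifier Q R μ ∧ ∀ ν : Unifier ar C V, IsPieceUnifier Q R ν →
    ν.query = μ.query → ν.head = μ.head → ν.part.Finer μ.part → μ.part.Finer ν.part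

/-- The one-step rewriting `β(Q, R, μ) = s(body R) ∪ s(Q \ Q')`, computed with the substitution
`s` (which is to be associated with the partition of `μ`). -/
noncomputable def rewriting (Q : Query ar C V) (R : Rule ar C V) (μ : Unifier ar C V)
    (s : Subst C V) : Query ar C V :=
  s.onQuery R.body ∪ s.onQuery (Q \ μ.query)

/-- A compatible family of piece-unifiers `U i` of `Q` with rules `Rs i` that have pairwise
disjoint sets of variables. -/
structure Compatible {k : ℕ} (Q : Query ar C V) (Rs : Fin k → Rule ar C V)
    (U : Fin k → Unifier ar C V) : Prop where
  pieceUnifier : ∀ i, IsPieceUnifier Q (Rs i) (U i)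
  disjoint_vars : ∀ i j, i ≠ j → Disjoint (Rs i).vars (Rs j).vars
  disjoint_query : ∀ i j, i ≠ j → Disjoint (U i).query (U j).query
  admissible : (TermPartition.join fun i => (U i).part).Admissible

/-- The aggregated unifier of a family of piece-unifiers. -/
noncomputable def aggregatedUnifier {k : ℕ} (U : Fin k → Unifier ar C V) : Unifier ar C V where
  query := Finset.univ.biUnion fun i => (U i).query
  head := Finset.univ.biUnion fun i => (U i).head
  part := TermPartition.join fun i => (U i).part

/-- The aggregation `R₁ ⋄ … ⋄ Rₖ` of rules. -/
noncomputable def aggregatedRule {k : ℕ} (Rs : Fin k → Rule ar C V) : Rule ar C V where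
  body := Finset.univ.biUnion fun i => (Rs i).body
  head := Finset.univ.biUnion fun i => (Rs i).head

/-- `U` is a non-empty compatible family of most general single-piece unifiers of `Q` with copies
`Rs` of the rule `R`, so that `aggregatedUnifier U` is a most general single-piece aggregated
unifier of `Q` with `Rs`. -/
structure IsMGSinglePieceFamily {k : ℕ} (Q : Query ar C V) (R : Rule ar C V)
    (Rs : Fin k → Rule ar C V) (U : Fin k → Unifier ar C V) : Prop where
  pos : 0 < k
  copy : ∀ i, R.IsCopy (Rs i)
  compatible : Compatible Q Rs U
  singlePiece : ∀ i, IsSinglePieceUnifier Q (Rs i) (U i)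
  mostGeneral : ∀ i, IsMostGeneral Q (Rs i) (U i)

/-- The single-piece aggregator: all the one-step rewritings of `Q` according to the most general
single-piece aggregated unifiers of `Q` with copies of a rule of `𝓡`. -/
def singlePieceAggregator {P : Type u} (ar : P → ℕ) (C V : Type u) : RewOp ar C V :=
  fun Q 𝓡 => {Q' | ∃ R ∈ 𝓡, ∃ (k : ℕ) (Rs : Fin k → Rule ar C V) (U : Fin k → Unifier ar C V),
    IsMGSinglePieceFamily Q R Rs U ∧
    ∃ s : Subst C V, (aggregatedUnifier U).part.IsAssociated s ∧
      Q' = rewriting Q (aggregatedRule Rs) (aggregatedUnifier U) s}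

end Unifiers

end ExRules

/-! Completeness, prunability and (b) are three instances of one construction,
`exists_isMGSinglePieceFamily`. Work in an interpretation `M` where distinct constants have distinct
values, with an assignment `h` of `Q`. Suppose disjoint parts `B j` of `Q` are matched, via
assignments `g j`, with atoms of the head of `R`, so that an existential variable shares its value
only with variables confined to `B j` (`PieceMatch`). Suppose also that the bodies hold under the `g
j` and that the rest of `Q` holds under `h`. Each `B j` splits into pieces, and each piece receives
its own fresh copy of `R`. Gluing `h` with the relevant `g j` on each copy yields a single
assignment `σ`. On each piece, the kernel of `σ` is a piece-unifier, and a finest refinement of it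
is most general. All these partitions refine the kernel of `σ`, hence so does their join: it is
admissible because constants have distinct values, and `σ` satisfies the aggregated rewriting.

In the interpretation made of the atoms of a query `A`, satisfaction of `B` means `B ≥ A`. Taking
`A` to be the given rewriting of `Q` gives (b); taking `A = Q₂'` and pulling the unifier of `Q₂`
back along `Q₁ ≥ Q₂` gives prunability. For completeness, `M` is a stage of the Skolem chase: the
nulls of the last trigger are fresh, so the atoms of `Q` that need this trigger form a `PieceMatch`,
and rewriting undoes one chase step (`ChaseStep.exists_rewriting`).

Soundness is semantic (`IsPieceUnifier.satQuery`) once (a) is known. Statement (a) rests on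
`Compatible.rel_of_join_rel`: the join leaves the classes of existential variables unchanged. -/

namespace ExRules

/-! ### Atoms, variables, and partitions with their associated substitutions -/

section Basics

variable {P C V : Type u} {ar : P → ℕ}

/-- Two atoms have the same predicate and `r`-related arguments. -/
inductive AtomRel (r : Term C V → Term C V → Prop) : Atom ar C V → Atom ar C V → Prop
  | mk (p : P) (s t : Fin (ar p) → Term C V) (h : ∀ i, r (s i) (t i)) : AtomRel r ⟨p, s⟩ ⟨p, t⟩

theorem AtomRel.imp {r r' : Term C V → Term C V → Prop} {a b : Atom ar C V}
    (h : AtomRel r a b) (hr : ∀ i j, r (a.args i) (b.args j) → r' (a.args i) (b.args j)) :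
    AtomRel r' a b := by
  cases h with
  | mk p s t h => exact .mk p s t fun i => hr i i (h i)

theorem AtomRel.swap {r : Term C V → Term C V → Prop} {a b : Atom ar C V}
    (h : AtomRel r a b) : AtomRel (fun t t' => r t' t) b a := by
  cases h with
  | mk p s t h => exact .mk p t s h

theorem AtomRel.exists_right {r : Term C V → Term C V → Prop} {a b : Atom ar C V}
    (h : AtomRel r a b) (i : Fin (ar a.pred)) : ∃ j, r (a.args i) (b.args j) := by
  cases h with
  | mk p s t h => exact ⟨i, h i⟩

theorem AtomRel.onAtom_left {r : Term C V → Term C V → Prop} {a b : Atom ar C V} {s : Subst C V} :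
    AtomRel r (s.onAtom a) b ↔ AtomRel (fun t t' => r (s.onTerm t) t') a b := by
  constructor
  · intro h
    obtain ⟨p, x⟩ := a
    cases h with
    | mk _ _ t h => exact .mk p x t h
  · intro h
    cases h with
    | mk p x t h => exact .mk p _ t h

theorem AtomRel.onAtom_right {r : Term C V → Term C V → Prop} {a b : Atom ar C V}
    {s : Subst C V} :
    AtomRel r a (s.onAtom b) ↔ AtomRel (fun t t' => r t (s.onTerm t')) a b :=
  ⟨fun h => (onAtom_left.1 h.swap).swap, fun h => (onAtom_left.2 h.swap).swap⟩

theorem atomRel_eq_iff {a b : Atom ar C V} : AtomRel Eq a b ↔ a = b := by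
  constructor
  · intro h
    cases h with
    | mk p s t h => rw [funext h]
  · rintro rfl
    exact .mk _ _ _ fun _ => rfl

theorem onAtom_eq_onAtom_iff {s s' : Subst C V} {a b : Atom ar C V} :
    s.onAtom a = s'.onAtom b ↔ AtomRel (fun t t' => s.onTerm t = s'.onTerm t') a b := by
  rw [← atomRel_eq_iff, AtomRel.onAtom_left, AtomRel.onAtom_right]

/-- Equality of ground atoms is an equality of dependent pairs; passing to `AtomRel` confines the
transport along equal predicates to this place. -/
theorem atomRel_of_sigma_eq {X : Type*} {v w : Term C V → X} {a b : Atom ar C V}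
    (h : (⟨a.pred, fun i => v (a.args i)⟩ : Σ p, Fin (ar p) → X) =
      ⟨b.pred, fun i => w (b.args i)⟩) : AtomRel (fun t t' => v t = w t') a b := by
  obtain ⟨p, x⟩ := a
  obtain ⟨q, y⟩ := b
  obtain ⟨rfl, h⟩ := Sigma.mk.inj h
  exact .mk _ _ _ fun i => congrFun (eq_of_heq h) i

theorem AtomRel.pred_iff {M : Interp ar C} {v w : Term C V → M.D} {a b : Atom ar C V}
    (h : AtomRel (fun t t' => v t = w t') a b) :
    M.pred a.pred (fun i => v (a.args i)) ↔ M.pred b.pred (fun i => w (b.args i)) := by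
  cases h with
  | mk p s t h => simp only [h]

theorem vars_mono {A B : Query ar C V} (h : A ⊆ B) : vars A ⊆ vars B :=
  fun _ ⟨a, ha, i⟩ => ⟨a, h ha, i⟩

theorem terms_mono {A B : Query ar C V} (h : A ⊆ B) : terms A ⊆ terms B :=
  fun _ ⟨a, ha, i⟩ => ⟨a, h ha, i⟩

theorem var_mem_terms {A : Query ar C V} {v : V} : Term.var v ∈ terms A ↔ v ∈ vars A := Iff.rfl

theorem args_mem_terms {A : Query ar C V} {a : Atom ar C V} (ha : a ∈ A) (i : Fin (ar a.pred)) :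
    a.args i ∈ terms A := ⟨a, ha, i, rfl⟩

theorem mem_vars_singleton {a : Atom ar C V} {v : V} :
    v ∈ vars {a} ↔ ∃ i, a.args i = Term.var v := by
  simp [vars]

theorem terms_finite (A : Query ar C V) : (terms A).Finite := by
  have : terms A = ⋃ a ∈ A, Set.range a.args := by
    ext t; simp [terms]
  rw [this]
  exact A.finite_toSet.biUnion fun a _ => Set.finite_range _

theorem vars_finite (A : Query ar C V) : (vars A).Finite :=
  (terms_finite A).preimage (f := Term.var) (fun _ _ _ _ h => Term.var.inj h)

theorem mem_onQuery {s : Subst C V} {A : Query ar C V} {b : Atom ar C V} :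
    b ∈ s.onQuery A ↔ ∃ a ∈ A, s.onAtom a = b := by
  simp [Subst.onQuery]

theorem onAtom_mem_onQuery {s : Subst C V} {A : Query ar C V} {a : Atom ar C V} (h : a ∈ A) :
    s.onAtom a ∈ s.onQuery A := mem_onQuery.2 ⟨a, h, rfl⟩

theorem mem_terms_onQuery {s : Subst C V} {A : Query ar C V} {t : Term C V} :
    t ∈ terms (s.onQuery A) ↔ ∃ t' ∈ terms A, s.onTerm t' = t := by
  constructor
  · rintro ⟨b, hb, i, rfl⟩
    obtain ⟨a, ha, rfl⟩ := mem_onQuery.1 hb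
    exact ⟨a.args i, args_mem_terms ha i, rfl⟩
  · rintro ⟨t', ⟨a, ha, i, rfl⟩, rfl⟩
    exact args_mem_terms (onAtom_mem_onQuery ha) i

theorem terms_biUnion {ι : Type} [Fintype ι] (A : ι → Query ar C V) :
    terms (Finset.univ.biUnion A) = ⋃ i, terms (A i) := by
  ext t
  simp only [terms, Finset.mem_biUnion, Finset.mem_univ, true_and, Set.mem_ofPred_eq,
    Set.mem_iUnion]
  tauto

theorem vars_biUnion {ι : Type} [Fintype ι] (A : ι → Query ar C V) :
    vars (Finset.univ.biUnion A) = ⋃ i, vars (A i) := by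
  ext v
  simpa [var_mem_terms] using Set.ext_iff.1 (terms_biUnion A) (Term.var v)

theorem mem_exVars {R : Rule ar C V} {v : V} : v ∈ R.exVars ↔ v ∈ vars R.head ∧ v ∉ vars R.body := by
  simp only [Rule.exVars, Rule.frontier, Set.mem_sdiff, Set.mem_inter_iff]
  tauto

theorem exVars_subset_vars (R : Rule ar C V) : R.exVars ⊆ R.vars :=
  fun _ h => .inr (mem_exVars.1 h).1

theorem Rule.vars_finite (R : Rule ar C V) : R.vars.Finite :=
  (ExRules.vars_finite _).union (ExRules.vars_finite _)

/-! ### Associated substitutions -/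

theorem TermPartition.mem_support_left {p : TermPartition C V} {s t : Term C V} (h : p.rel s t) :
    s ∈ p.support := p.trans h (p.symm h)

theorem TermPartition.mem_support_right {p : TermPartition C V} {s t : Term C V} (h : p.rel s t) :
    t ∈ p.support := p.trans (p.symm h) h

theorem TermPartition.IsAssociated.rel_onTerm {p : TermPartition C V} {s : Subst C V}
    (h : p.IsAssociated s) {t : Term C V} (ht : t ∈ p.support) : p.rel t (s.onTerm t) := by
  cases t with
  | var v => exact h.mem_class v ht
  | const c => exact ht

theorem TermPartition.IsAssociated.onTerm_eq_self {p : TermPartition C V} {s : Subst C V}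
    (h : p.IsAssociated s) {t : Term C V} (ht : t ∉ p.support) : s.onTerm t = t := by
  cases t with
  | var v => exact h.eq_self v ht
  | const c => rfl

theorem TermPartition.IsAssociated.rel_of_eq {p : TermPartition C V} {s : Subst C V}
    (h : p.IsAssociated s) {t t' : Term C V} (ht : t ∈ p.support) (ht' : t' ∈ p.support)
    (e : s.onTerm t = s.onTerm t') : p.rel t t' :=
  p.trans (h.rel_onTerm ht) (e ▸ p.symm (h.rel_onTerm ht'))

/-- A function that is constant on the classes is invariant under associated substitutions. -/
theorem TermPartition.IsAssociated.apply_onTerm {p : TermPartition C V} {s : Subst C V}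
    (h : p.IsAssociated s) {X : Type*} {v : Term C V → X} (hv : ∀ t t', p.rel t t' → v t = v t')
    (t : Term C V) : v (s.onTerm t) = v t := by
  by_cases ht : t ∈ p.support
  · exact (hv _ _ (h.rel_onTerm ht)).symm
  · rw [h.onTerm_eq_self ht]

theorem TermPartition.Admissible.exists_isAssociated {p : TermPartition C V} (hp : p.Admissible) :
    ∃ s, p.IsAssociated s := by
  classical
  have hex : ∀ t, t ∈ p.support → ∃ t', p.rel t t' ∧ ∀ c, p.rel t (.const c) → t' = .const c := by
    intro t ht
    by_cases hc : ∃ c, p.rel t (.const c)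
    · obtain ⟨c, hc⟩ := hc
      exact ⟨_, hc, fun d hd => congrArg _ (hp _ _ (p.trans (p.symm hc) hd))⟩
    · exact ⟨t, ht, fun c h => (hc ⟨c, h⟩).elim⟩
  -- The representative is an `epsilon` of a predicate that depends on the class alone, so two terms
  -- of one class get the same representative; `N` gives priority to constants.
  let N : (Term C V → Prop) → Term C V → Prop :=
    fun K t' => K t' ∧ ∀ c, K (.const c) → t' = .const c
  have hN : ∀ t (ht : t ∈ p.support),
      N (p.rel t) (@Classical.epsilon _ ⟨t⟩ (N (p.rel t))) := fun t ht =>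
    Classical.epsilon_spec_aux ⟨t⟩ _ (hex t ht)
  have hcl : ∀ t t', p.rel t t' → p.rel t = p.rel t' := fun t t' h => by
    ext x
    exact ⟨fun h' => p.trans (p.symm h) h', fun h' => p.trans h h'⟩
  refine ⟨fun v => if Term.var v ∈ p.support then
    @Classical.epsilon _ ⟨.var v⟩ (N (p.rel (.var v))) else .var v, ?_, ?_, ?_⟩
  · intro v hv
    simp only [if_pos hv]
    exact (hN _ hv).1
  · intro t t' h
    have h1 := p.mem_support_left h
    have h2 := p.mem_support_right h
    cases t with
    | const c =>
      cases t' with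
      | const d => exact congrArg Term.const (hp _ _ h)
      | var w =>
        simp only [Subst.onTerm, if_pos h2]
        exact ((hN _ h2).2 c (p.symm h)).symm
    | var v =>
      cases t' with
      | const d =>
        simp only [Subst.onTerm, if_pos h1]
        exact (hN _ h1).2 d h
      | var w =>
        simp only [Subst.onTerm, if_pos h1, if_pos h2]
        rw [hcl _ _ h]
  · intro v hv
    exact if_neg hv

/-- Unification by the associated substitutions, in terms of the classes. -/
theorem forall_isAssociated_onQuery_eq_iff {p : TermPartition C V} (hp : p.Admissible)
    {A B : Query ar C V} (hs : p.support = terms A ∪ terms B) :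
    (∀ s : Subst C V, p.IsAssociated s → s.onQuery B = s.onQuery A) ↔
      (∀ a ∈ A, ∃ b ∈ B, AtomRel p.rel a b) ∧ (∀ b ∈ B, ∃ a ∈ A, AtomRel p.rel a b) := by
  have hA : ∀ a ∈ A, ∀ i, a.args i ∈ p.support := fun a ha i =>
    hs ▸ .inl (args_mem_terms ha i)
  have hB : ∀ a ∈ B, ∀ i, a.args i ∈ p.support := fun a ha i =>
    hs ▸ .inr (args_mem_terms ha i)
  constructor
  · intro h
    obtain ⟨s, hs⟩ := hp.exists_isAssociated
    have key : ∀ a ∈ A, ∀ b ∈ B, s.onAtom a = s.onAtom b → AtomRel p.rel a b :=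
      fun a ha b hb e => (onAtom_eq_onAtom_iff.1 e).imp fun i j =>
        hs.rel_of_eq (hA a ha i) (hB b hb j)
    constructor
    · intro a ha
      obtain ⟨b, hb, e⟩ := mem_onQuery.1 (h s hs ▸ onAtom_mem_onQuery ha)
      exact ⟨b, hb, key a ha b hb e.symm⟩
    · intro b hb
      obtain ⟨a, ha, e⟩ := mem_onQuery.1 (h s hs ▸ onAtom_mem_onQuery hb : s.onAtom b ∈ s.onQuery A)
      exact ⟨a, ha, key a ha b hb e⟩
  · rintro ⟨h1, h2⟩ s hs
    have key : ∀ a b : Atom ar C V, AtomRel p.rel a b → s.onAtom a = s.onAtom b := fun a b e =>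
      onAtom_eq_onAtom_iff.2 (e.imp fun i j => hs.const_on_class _ _)
    ext x
    simp only [mem_onQuery]
    constructor
    · rintro ⟨b, hb, rfl⟩
      obtain ⟨a, ha, e⟩ := h2 b hb
      exact ⟨a, ha, key a b e⟩
    · rintro ⟨a, ha, rfl⟩
      obtain ⟨b, hb, e⟩ := h1 a ha
      exact ⟨b, hb, (key a b e).symm⟩

end Basics

/-! ### Piece-unifiers and their aggregation -/

section PieceUnifiers

variable {P C V : Type u} {ar : P → ℕ} {Q : Query ar C V} {R : Rule ar C V} {μ : Unifier ar C V}

theorem IsPieceUnifier.atomRel (h : IsPieceUnifier Q R μ) :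
    (∀ a ∈ μ.query, ∃ b ∈ μ.head, AtomRel μ.part.rel a b) ∧
      (∀ b ∈ μ.head, ∃ a ∈ μ.query, AtomRel μ.part.rel a b) :=
  (forall_isAssociated_onQuery_eq_iff h.admissible h.support_eq).1 h.unifies

theorem IsPieceUnifier.vars_query_subset (h : IsPieceUnifier Q R μ) : vars μ.query ⊆ vars Q :=
  vars_mono h.query_subset

theorem IsPieceUnifier.vars_head_subset (h : IsPieceUnifier Q R μ) : vars μ.head ⊆ R.vars :=
  (vars_mono h.head_subset).trans Set.subset_union_right

theorem IsPieceUnifier.notMem_vars (h : IsPieceUnifier Q R μ) {v : V} (hv : v ∈ R.vars) :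
    v ∉ vars Q := fun hq => Set.disjoint_left.1 h.disjoint_vars hq hv

/-- A term of the head that shares a class with an existential variable is this variable. -/
theorem IsPieceUnifier.eq_of_mem_head (h : IsPieceUnifier Q R μ) {y : V} (hy : y ∈ R.exVars)
    {t : Term C V} (ht : t ∈ terms μ.head) (hr : μ.part.rel (.var y) t) : t = .var y := by
  by_contra hne
  obtain ⟨x, rfl, hx, -⟩ := h.existential y hy t hr hne
  exact h.notMem_vars (h.vars_head_subset ht) (h.vars_query_subset hx)

/-- A term of the query that shares a class with an existential variable is a variable that
does not occur in the rest of the query. -/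
theorem IsPieceUnifier.of_mem_query (h : IsPieceUnifier Q R μ) {y : V} (hy : y ∈ R.exVars)
    {t : Term C V} (ht : t ∈ terms Q) (hr : μ.part.rel (.var y) t) :
    ∃ x, t = .var x ∧ x ∈ vars μ.query ∧ x ∉ vars (Q \ μ.query) := by
  refine h.existential y hy t hr ?_
  rintro rfl
  exact h.notMem_vars (exVars_subset_vars R hy) ht

/-! ### Aggregation -/

variable {k : ℕ} {Rs : Fin k → Rule ar C V} {U : Fin k → Unifier ar C V}

/-- Apart from `y`, the class of `y` in the `i`-th partition consists of variables of the `i`-th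
part of `Q` that do not occur outside it. Disjointness of the parts and of the rules keeps all these
terms out of the other partitions, so nothing is ever merged into this class. -/
theorem Compatible.rel_of_join_rel (h : Compatible Q Rs U) {i : Fin k} {y : V}
    (hy : y ∈ (Rs i).exVars) {t : Term C V}
    (ht : (TermPartition.join fun i => (U i).part).rel (.var y) t) :
    (U i).part.rel (.var y) t := by
  have hyv := exVars_subset_vars _ hy
  have hsupp : ∀ j, ∀ v, Term.var v ∈ (U j).part.support → v ∈ vars (U j).query ∨
      v ∈ (Rs j).vars := fun j v hv => by
    rw [(h.pieceUnifier j).support_eq] at hv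
    exact hv.imp id fun hv => (h.pieceUnifier j).vars_head_subset hv
  have hyj : ∀ j, Term.var y ∈ (U j).part.support → j = i := by
    intro j hj
    by_contra hne
    rcases hsupp j y hj with hv | hv
    · exact (h.pieceUnifier i).notMem_vars hyv ((h.pieceUnifier j).vars_query_subset hv)
    · exact Set.disjoint_left.1 (h.disjoint_vars j i hne) hv hyv
  induction ht with
  | single hr =>
    obtain ⟨j, hr⟩ := hr
    obtain rfl := hyj j ((U j).part.mem_support_left hr)
    exact hr
  | @tail b c _ hr ih =>
    obtain ⟨j, hr⟩ := hr
    by_cases hji : j = i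
    · subst hji
      exact (U j).part.trans ih hr
    exfalso
    have hb := (U j).part.mem_support_left hr
    by_cases hby : b = .var y
    · subst hby
      exact hji (hyj j hb)
    obtain ⟨x, rfl, hx, hx'⟩ := (h.pieceUnifier i).existential y hy b ih hby
    rcases hsupp j x hb with hv | hv
    · refine hx' (vars_mono ?_ hv)
      intro a ha
      exact Finset.mem_sdiff.2 ⟨(h.pieceUnifier j).query_subset ha,
        Finset.disjoint_left.1 (h.disjoint_query j i hji) ha⟩
    · exact (h.pieceUnifier j).notMem_vars hv ((h.pieceUnifier i).vars_query_subset hx)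

theorem mem_exVars_aggregatedRule (hd : ∀ i j, i ≠ j → Disjoint (Rs i).vars (Rs j).vars) {v : V} :
    v ∈ (aggregatedRule Rs).exVars ↔ ∃ i, v ∈ (Rs i).exVars := by
  simp only [mem_exVars, aggregatedRule, vars_biUnion, Set.mem_iUnion, not_exists]
  constructor
  · rintro ⟨⟨i, hi⟩, h⟩
    exact ⟨i, hi, h i⟩
  · rintro ⟨i, hi, h⟩
    refine ⟨⟨i, hi⟩, fun j hj => ?_⟩
    by_cases hij : i = j
    · exact h (hij ▸ hj)
    · exact Set.disjoint_left.1 (hd i j hij) (.inr hi) (.inl hj)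

theorem join_support {ι : Type} (p : ι → TermPartition C V) :
    (TermPartition.join p).support = ⋃ i, (p i).support := by
  ext t
  simp only [Set.mem_iUnion]
  constructor
  · intro h
    obtain ⟨_, ⟨i, hi⟩, -⟩ := Relation.TransGen.head'_iff.1 h
    exact ⟨i, (p i).mem_support_left hi⟩
  · rintro ⟨i, hi⟩
    exact .single ⟨i, hi⟩

theorem Compatible.aggregatedUnifier_support_eq (h : Compatible Q Rs U) :
    (aggregatedUnifier U).part.support =
      terms (aggregatedUnifier U).query ∪ terms (aggregatedUnifier U).head := by
  simp only [aggregatedUnifier, join_support, terms_biUnion, ← Set.iUnion_union_distrib]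
  exact Set.iUnion_congr fun i => (h.pieceUnifier i).support_eq

theorem Compatible.isPieceUnifier_aggregatedUnifier (hk : 0 < k) (h : Compatible Q Rs U) :
    IsPieceUnifier Q (aggregatedRule Rs) (aggregatedUnifier U) where
  disjoint_vars := by
    have := fun i => (h.pieceUnifier i).disjoint_vars
    simp only [Rule.vars, aggregatedRule, vars_biUnion, Set.disjoint_union_right,
      Set.disjoint_iUnion_right] at this ⊢
    exact ⟨fun i => (this i).1, fun i => (this i).2⟩
  nonempty := by
    obtain ⟨a, ha⟩ := (h.pieceUnifier ⟨0, hk⟩).nonempty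
    exact ⟨a, Finset.mem_biUnion.2 ⟨_, Finset.mem_univ _, ha⟩⟩
  query_subset := Finset.biUnion_subset.2 fun i _ => (h.pieceUnifier i).query_subset
  head_subset := Finset.biUnion_mono fun i _ => (h.pieceUnifier i).head_subset
  support_eq := h.aggregatedUnifier_support_eq
  admissible := h.admissible
  existential := by
    intro y hy t ht hne
    obtain ⟨i, hy⟩ := (mem_exVars_aggregatedRule h.disjoint_vars).1 hy
    obtain ⟨x, rfl, hx, hx'⟩ :=
      (h.pieceUnifier i).existential y hy t (h.rel_of_join_rel hy ht) hne
    have hsub : (U i).query ⊆ (aggregatedUnifier U).query :=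
      Finset.subset_biUnion_of_mem (fun i => (U i).query) (Finset.mem_univ i)
    exact ⟨x, rfl, vars_mono hsub hx,
      fun hxx => hx' (vars_mono (Finset.sdiff_subset_sdiff le_rfl hsub) hxx)⟩
  unifies := by
    refine (forall_isAssociated_onQuery_eq_iff (p := (aggregatedUnifier U).part)
      h.admissible h.aggregatedUnifier_support_eq).2 ?_
    have hr : ∀ i (a b : Atom ar C V), AtomRel (U i).part.rel a b →
        AtomRel (TermPartition.join fun i => (U i).part).rel a b := fun i a b e =>
      e.imp fun _ _ hr => .single ⟨i, hr⟩
    constructor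
    · intro a ha
      obtain ⟨i, -, ha⟩ := Finset.mem_biUnion.1 ha
      obtain ⟨b, hb, e⟩ := (h.pieceUnifier i).atomRel.1 a ha
      exact ⟨b, Finset.mem_biUnion.2 ⟨i, Finset.mem_univ _, hb⟩, hr i _ _ e⟩
    · intro b hb
      obtain ⟨i, -, hb⟩ := Finset.mem_biUnion.1 hb
      obtain ⟨a, ha, e⟩ := (h.pieceUnifier i).atomRel.2 b hb
      exact ⟨a, Finset.mem_biUnion.2 ⟨i, Finset.mem_univ _, ha⟩, hr i _ _ e⟩

end PieceUnifiers

/-! ### Semantics of rules, and soundness -/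

section Soundness

variable {P C V : Type u} {ar : P → ℕ} {Q : Query ar C V} {R : Rule ar C V} {μ : Unifier ar C V}

theorem Interp.val_congr (M : Interp ar C) {α β : V → M.D} {t : Term C V}
    (h : ∀ v, t = .var v → α v = β v) : M.val α t = M.val β t := by
  cases t with
  | var v => exact h v rfl
  | const c => rfl

theorem Interp.val_onTerm (M : Interp ar C) (α : V → M.D) (s : Subst C V) (t : Term C V) :
    M.val α (s.onTerm t) = M.val (fun v => M.val α (s v)) t := by
  cases t <;> rfl

theorem Interp.holds_onQuery {M : Interp ar C} {α : V → M.D} {s : Subst C V}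
    {A : Query ar C V} : M.Holds α (s.onQuery A) ↔ M.Holds (fun v => M.val α (s v)) A := by
  simp only [Interp.Holds, Subst.onQuery, Finset.forall_mem_image, Subst.onAtom,
    Interp.val_onTerm]

theorem Interp.holds_union {M : Interp ar C} {α : V → M.D} {A B : Query ar C V} :
    M.Holds α (A ∪ B) ↔ M.Holds α A ∧ M.Holds α B := Finset.forall_mem_union

theorem Interp.Holds.congr {M : Interp ar C} {α β : V → M.D} {A : Query ar C V}
    (h : M.Holds α A) (hv : ∀ v ∈ vars A, α v = β v) : M.Holds β A := by
  intro a ha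
  have : (fun i => M.val β (a.args i)) = fun i => M.val α (a.args i) := funext fun i =>
    M.val_congr fun v e => (hv v ⟨a, ha, i, e⟩).symm
  rw [this]
  exact h a ha

/-- If a rule is satisfied, a query holds as soon as its rewriting does. -/
theorem IsPieceUnifier.satQuery {M : Interp ar C} (h : IsPieceUnifier Q R μ) (hM : M.SatRule R)
    {s : Subst C V} (hs : μ.part.IsAssociated s) (hr : M.SatQuery (rewriting Q R μ s)) :
    M.SatQuery Q := by
  classical
  obtain ⟨α, hα⟩ := hr
  rw [rewriting, Interp.holds_union, Interp.holds_onQuery, Interp.holds_onQuery] at hα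
  set γ : V → M.D := fun v => M.val α (s v) with hγ
  obtain ⟨β, hβ, hhead⟩ := hM γ hα.1
  -- The variables unified with an existential variable `y` take the value that the rule provides
  -- for `y`; all others keep the value read through `s`. Atoms outside `Q'` only see the second
  -- case.
  let δ : V → M.D := fun x =>
    if h : ∃ y ∈ R.exVars, μ.part.rel (.var y) (.var x) then β h.choose else γ x
  have hδ : ∀ x ∈ vars Q, ∀ y ∈ R.exVars, μ.part.rel (.var y) (.var x) → δ x = β y := by
    intro x hx y hy hr
    have hex : ∃ y ∈ R.exVars, μ.part.rel (.var y) (.var x) := ⟨y, hy, hr⟩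
    have hsp := hex.choose_spec
    have hyy := μ.part.trans hr (μ.part.symm hsp.2)
    -- A class has at most one existential variable: a second one would have to be a variable of
    -- `Q`.
    have : hex.choose = y := by
      by_contra hne
      obtain ⟨x', e, hx', -⟩ := h.existential y hy _ hyy (fun e => hne (Term.var.inj e))
      cases e
      exact h.notMem_vars (exVars_subset_vars R hsp.1) (h.vars_query_subset hx')
    simp only [δ, dif_pos hex, this]
  refine ⟨δ, fun a ha => ?_⟩
  by_cases haq : a ∈ μ.query
  · obtain ⟨b, hb, e⟩ := h.atomRel.1 a haq
    refine (AtomRel.pred_iff (v := M.val δ) (w := M.val β) (e.imp fun i j hr => ?_)).2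
      (hhead b (h.head_subset hb))
    have htQ := args_mem_terms ha i
    have htH := args_mem_terms hb j
    generalize a.args i = t at *
    generalize b.args j = t' at *
    by_cases hy : ∃ y ∈ R.exVars, μ.part.rel (.var y) t
    · obtain ⟨y, hy, hyt⟩ := hy
      obtain ⟨x, rfl, -, -⟩ := h.of_mem_query hy htQ hyt
      rw [h.eq_of_mem_head hy htH (μ.part.trans hyt hr)]
      exact hδ x htQ y hy hyt
    · have h1 : M.val δ t = M.val γ t := M.val_congr fun v e => by
        subst e
        exact dif_neg hy
      have h2 : M.val β t' = M.val γ t' := M.val_congr fun v e => by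
        subst e
        exact hβ v fun hv => hy ⟨v, hv, μ.part.symm hr⟩
      rw [h1, h2, hγ, ← M.val_onTerm, ← M.val_onTerm, hs.const_on_class _ _ hr]
  · have haQ : a ∈ Q \ μ.query := Finset.mem_sdiff.2 ⟨ha, haq⟩
    have : (fun i => M.val δ (a.args i)) = fun i => M.val γ (a.args i) := by
      funext i
      refine M.val_congr fun x e => dif_neg ?_
      rintro ⟨y, hy, hr⟩
      obtain ⟨x', e', -, hx'⟩ := h.of_mem_query hy (t := .var x) (e ▸ args_mem_terms ha i) hr
      cases e'
      exact hx' ⟨a, haQ, i, e⟩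
    rw [this]
    exact hα.2 a haQ

theorem vars_onQuery_rename (f : V → V) (A : Query ar C V) :
    vars (Subst.onQuery (fun v => Term.var (f v)) A) = f '' vars A := by
  ext v
  rw [← var_mem_terms, mem_terms_onQuery]
  constructor
  · rintro ⟨t | c, ht, e⟩
    · exact ⟨t, ht, Term.var.inj e⟩
    · cases e
  · rintro ⟨w, hw, rfl⟩
    exact ⟨_, hw, rfl⟩

/-- The image of a rule by a renaming of its variables. -/
noncomputable def Rule.rename (f : V → V) (R : Rule ar C V) : Rule ar C V where
  body := Subst.onQuery (fun v => Term.var (f v)) R.body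
  head := Subst.onQuery (fun v => Term.var (f v)) R.head

theorem Rule.isCopy_iff {R R' : Rule ar C V} :
    R.IsCopy R' ↔ ∃ f : V → V, Set.InjOn f R.vars ∧ R' = R.rename f := by
  refine exists_congr fun f => and_congr_right fun _ => ?_
  cases R'
  simp [Rule.rename]

theorem Rule.vars_rename (f : V → V) (R : Rule ar C V) : (R.rename f).vars = f '' R.vars := by
  simp only [Rule.vars, Rule.rename, vars_onQuery_rename, Set.image_union]

theorem Rule.exVars_rename {f : V → V} {R : Rule ar C V} (hf : Set.InjOn f R.vars) :
    (R.rename f).exVars = f '' R.exVars := by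
  ext v
  simp only [mem_exVars, Rule.rename, vars_onQuery_rename]
  constructor
  · rintro ⟨⟨w, hw, rfl⟩, h⟩
    exact ⟨w, mem_exVars.2 ⟨hw, fun hb => h ⟨w, hb, rfl⟩⟩, rfl⟩
  · rintro ⟨w, hw, rfl⟩
    rw [mem_exVars] at hw
    refine ⟨⟨w, hw.1, rfl⟩, ?_⟩
    rintro ⟨w', hw', e⟩
    exact hw.2 (hf (.inl hw') (.inr hw.1) e ▸ hw')

theorem Interp.SatRule.rename {M : Interp ar C} {f : V → V} (hf : Set.InjOn f R.vars)
    (h : M.SatRule R) : M.SatRule (R.rename f) := by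
  classical
  intro α hα
  obtain ⟨β, hβ, hhead⟩ := h (fun v => α (f v)) (Interp.holds_onQuery.1 hα)
  let β' : V → M.D := fun v => if h : ∃ y ∈ R.exVars, f y = v then β h.choose else α v
  refine ⟨β', fun v hv => dif_neg ?_, Interp.holds_onQuery.2 (hhead.congr fun v hv => ?_)⟩
  · rwa [Rule.exVars_rename hf] at hv
  · change β v = β' (f v)
    by_cases hex : ∃ y ∈ R.exVars, f y = f v
    · simp only [β', dif_pos hex]
      have := hex.choose_spec
      rw [hf (exVars_subset_vars R this.1) (.inr hv) this.2]
    · simp only [β', dif_neg hex]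
      exact hβ v fun hv => hex ⟨v, hv, rfl⟩

/-- The rules share no variable, so the values they provide for their existential variables can be
put together in one assignment. -/
theorem satRule_aggregatedRule {M : Interp ar C} {k : ℕ} {Rs : Fin k → Rule ar C V}
    (hd : ∀ i j, i ≠ j → Disjoint (Rs i).vars (Rs j).vars) (h : ∀ i, M.SatRule (Rs i)) :
    M.SatRule (aggregatedRule Rs) := by
  classical
  intro α hα
  have hbody : ∀ i, M.Holds α (Rs i).body := fun i a ha =>
    hα a (Finset.mem_biUnion.2 ⟨i, Finset.mem_univ _, ha⟩)
  choose β hβ hhead using fun i => h i α (hbody i)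
  let β' : V → M.D := fun v => if h : ∃ i, v ∈ (Rs i).exVars then β h.choose v else α v
  refine ⟨β', fun v hv => dif_neg ?_, fun a ha => ?_⟩
  · rwa [mem_exVars_aggregatedRule hd] at hv
  · obtain ⟨i, -, ha⟩ := Finset.mem_biUnion.1 ha
    refine (hhead i).congr (fun v hv => ?_) a ha
    by_cases hex : ∃ i, v ∈ (Rs i).exVars
    · have : hex.choose = i := by
        by_contra hne
        exact Set.disjoint_left.1 (hd _ _ hne) (exVars_subset_vars _ hex.choose_spec) (.inr hv)
      simp only [β', dif_pos hex, this]
    · simp only [β', dif_neg hex]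
      exact hβ i v fun hv => hex ⟨i, hv⟩

theorem singlePieceAggregator_sound : (singlePieceAggregator ar C V).Sound := by
  rintro 𝓡 Q _ ⟨R, hR, k, Rs, U, hU, s, hs, rfl⟩ F hF M hMF hM
  refine (hU.compatible.isPieceUnifier_aggregatedUnifier hU.pos).satQuery
    (satRule_aggregatedRule hU.compatible.disjoint_vars fun i => ?_) hs
    (hF M hMF fun _ h => h.elim)
  obtain ⟨f, hf, e⟩ := Rule.isCopy_iff.1 (hU.copy i)
  rw [e]
  exact (hM R hR).rename hf

end Soundness

/-! ### Pieces as minimal glue-closed sets -/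

section Pieces

variable {P C V : Type u} {ar : P → ℕ} {A B K K' : Query ar C V} {T T' : Set V}

/-- Sharing a variable outside `T` is a symmetric relation, so an atom outside a closed set cannot
be glued to one inside. -/
theorem GlueClosed.sdiff (h : GlueClosed A T B) (hK : GlueClosed A T K) :
    GlueClosed A T (B \ K) := by
  intro a ha a' ha' hm hs
  rw [Finset.mem_sdiff] at hm ⊢
  refine ⟨h a ha a' ha' hm.1 hs, fun hk => hm.2 (hK a' ha' a ha hk ?_)⟩
  rwa [Set.inter_comm]

theorem GlueClosed.inter (h : GlueClosed A T B) (hK : GlueClosed A T K) :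
    GlueClosed A T (B ∩ K) := by
  intro a ha a' ha' hm hs
  rw [Finset.mem_inter] at hm ⊢
  exact ⟨h a ha a' ha' hm.1 hs, hK a ha a' ha' hm.2 hs⟩

/-- A glue-closed set minimal among those containing `a` is a piece: a non-empty closed subset that
misses `a` could be removed from it, against minimality. -/
theorem GlueClosed.exists_isPiece (hB : B ⊆ A) (h : GlueClosed A T B) {a : Atom ar C V}
    (ha : a ∈ B) : ∃ K ⊆ B, a ∈ K ∧ IsPiece A T K := by
  obtain ⟨K, hKB, hK⟩ := exists_minimal_le_of_wellFoundedLT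
    (fun K => a ∈ K ∧ K ⊆ A ∧ GlueClosed A T K) B ⟨ha, hB, h⟩
  obtain ⟨haK, hKA, hKc⟩ := hK.prop
  refine ⟨K, hKB, haK, ⟨hKA, ⟨a, haK⟩, hKc⟩, ?_⟩
  rintro L ⟨hLA, ⟨b, hb⟩, hLc⟩ hLK
  by_cases haL : a ∈ L
  · exact hK.le_of_le ⟨haL, hLA, hLc⟩ hLK
  · have := hK.le_of_le (y := K \ L) ⟨Finset.mem_sdiff.2 ⟨haK, haL⟩,
      Finset.sdiff_subset.trans hKA, hKc.sdiff hLc⟩ Finset.sdiff_subset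
    exact ((Finset.mem_sdiff.1 (this (hLK hb))).2 hb).elim

theorem IsPiece.eq_of_not_disjoint (h : IsPiece A T K) (h' : IsPiece A T K')
    (hd : ¬ Disjoint K K') : K = K' := by
  have hp : (K ∩ K') ⊆ A ∧ (K ∩ K').Nonempty ∧ GlueClosed A T (K ∩ K') :=
    ⟨Finset.inter_subset_left.trans h.prop.1,
      Finset.nonempty_iff_ne_empty.2 fun e => hd (Finset.disjoint_iff_inter_eq_empty.2 e),
      h.prop.2.2.inter h'.prop.2.2⟩
  exact le_antisymm
    ((h.le_of_le hp Finset.inter_subset_left).trans Finset.inter_subset_right)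
    ((h'.le_of_le hp Finset.inter_subset_right).trans Finset.inter_subset_left)

/-- Being a piece only depends on the status of the variables of the piece. -/
theorem IsPiece.congr (h : IsPiece A T K) (hT : ∀ x ∈ vars K, x ∈ T ↔ x ∈ T') :
    IsPiece A T' K := by
  have key : ∀ L ⊆ K, GlueClosed A T L ↔ GlueClosed A T' L := by
    intro L hL
    have : ∀ a ∈ L, ∀ a' : Atom ar C V,
        vars {a} ∩ vars {a'} ⊆ T ↔ vars {a} ∩ vars {a'} ⊆ T' := by
      intro a ha a'
      refine forall_congr' fun x => forall_congr' fun hx => hT x ?_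
      exact vars_mono (Finset.singleton_subset_iff.2 (hL ha)) hx.1
    exact forall_congr' fun a => forall_congr' fun _ => forall_congr' fun a' =>
      forall_congr' fun _ => forall_congr' fun ha => by rw [this a ha a']
  refine ⟨⟨h.prop.1, h.prop.2.1, (key K le_rfl).1 h.prop.2.2⟩, fun L hL hLK => ?_⟩
  exact h.le_of_le ⟨hL.1, hL.2.1, (key L hLK).2 hL.2.2⟩ hLK

end Pieces

/-! ### Most general refinements -/

section Refinement

variable {P C V : Type u} {ar : P → ℕ} {Q : Query ar C V} {R : Rule ar C V} {μ ν : Unifier ar C V}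

/-- The partitioned set is finite, so a refinement with the fewest related pairs exists; no
piece-unifier is strictly finer. -/
theorem IsPieceUnifier.exists_isMostGeneral (h : IsPieceUnifier Q R μ) :
    ∃ ν : Unifier ar C V, ν.query = μ.query ∧ ν.head = μ.head ∧ ν.part.Finer μ.part ∧
      IsMostGeneral Q R ν := by
  let G : Unifier ar C V → Set (Term C V × Term C V) := fun ν => {x | ν.part.rel x.1 x.2}
  have hfin : ∀ ν, IsPieceUnifier Q R ν → (G ν).Finite := fun ν hν => by
    have := (terms_finite ν.query).union (terms_finite ν.head)
    rw [← hν.support_eq] at this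
    exact (this.prod this).subset fun x hx =>
      ⟨ν.part.mem_support_left hx, ν.part.mem_support_right hx⟩
  obtain ⟨ν, ⟨hν, hq, hh, hf⟩, hmin⟩ := (measure fun ν => (G ν).ncard).wf.has_min
    {ν | IsPieceUnifier Q R ν ∧ ν.query = μ.query ∧ ν.head = μ.head ∧ ν.part.Finer μ.part}
    ⟨μ, h, rfl, rfl, fun _ _ h => h⟩
  refine ⟨ν, hq, hh, hf, hν, fun ξ hξ hξq hξh hξf => ?_⟩
  have hle : (G ν).ncard ≤ (G ξ).ncard := Nat.not_lt.1 (hmin ξ ⟨hξ, hξq.trans hq, hξh.trans hh, fun s t e => hf s t (hξf s t e)⟩)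
  have := Set.eq_of_subset_of_ncard_le (s := G ξ) (t := G ν) (fun x hx => hξf _ _ hx) hle
    (hfin ν hν)
  intro s t hst
  exact (Set.ext_iff.1 this (s, t)).2 hst

/-- Refining the partition of a piece-unifier does not change its cutpoints. -/
theorem IsPieceUnifier.cutpoints_eq_of_finer (h : IsPieceUnifier Q R μ)
    (h' : IsPieceUnifier Q R ν) (hq : ν.query = μ.query) (hh : ν.head = μ.head)
    (hf : ν.part.Finer μ.part) : ν.cutpoints R = μ.cutpoints R := by
  ext x
  simp only [Unifier.cutpoints, hq]
  refine and_congr_right fun hx => forall_congr' fun y => forall_congr' fun hy =>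
    not_congr ⟨hf _ _, fun hr => ?_⟩
  -- The finer partition must still relate `x` to some term of the head; this term lies in the
  -- coarse class of `y`, where the only head term is `y`.
  obtain ⟨a, ha, i, e⟩ := hx
  obtain ⟨b, hb, hab⟩ := h'.atomRel.1 a (hq ▸ ha)
  obtain ⟨j, hj⟩ := hab.exists_right i
  rw [e] at hj
  have := h.eq_of_mem_head hy (hh ▸ args_mem_terms hb j) (μ.part.trans (μ.part.symm hr) (hf _ _ hj))
  rwa [this] at hj

end Refinement

/-! ### Piece-unifiers from kernels of assignments -/

section Kernels

variable {P C V : Type u} {ar : P → ℕ} {Q : Query ar C V} {R : Rule ar C V}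

/-- The partition of a set of terms into the fibres of a function. -/
def kernelPartition {X : Type*} (v : Term C V → X) (S : Set (Term C V)) : TermPartition C V where
  rel s t := s ∈ S ∧ t ∈ S ∧ v s = v t
  symm h := ⟨h.2.1, h.1, h.2.2.symm⟩
  trans h h' := ⟨h.1, h'.2.1, h.2.2.trans h'.2.2⟩

/-- The kernel of an interpretation of the terms gives a piece-unifier. -/
theorem isPieceUnifier_kernelPartition {M : Interp ar C} (hM : Function.Injective M.const)
    (σ : V → M.D) {B H : Query ar C V} (hd : Disjoint (vars Q) R.vars) (hne : B.Nonempty)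
    (hB : B ⊆ Q) (hH : H ⊆ R.head)
    (h₁ : ∀ a ∈ B, ∃ b ∈ H, AtomRel (fun t t' => M.val σ t = M.val σ t') a b)
    (h₂ : ∀ b ∈ H, ∃ a ∈ B, AtomRel (fun t t' => M.val σ t = M.val σ t') a b)
    (h₃ : ∀ y ∈ R.exVars, y ∈ vars H → ∀ t ∈ terms B, M.val σ t = σ y →
      ∃ x, t = .var x ∧ x ∉ vars (Q \ B))
    (h₄ : ∀ y ∈ R.exVars, y ∈ vars H → ∀ t ∈ terms H, M.val σ t = σ y → t = .var y) :
    IsPieceUnifier Q R ⟨B, H, kernelPartition (M.val σ) (terms B ∪ terms H)⟩ := by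
  have hadm : (kernelPartition (M.val σ) (terms B ∪ terms H)).Admissible :=
    fun c d h => hM h.2.2
  have hs : (kernelPartition (M.val σ) (terms B ∪ terms H)).support = terms B ∪ terms H := by
    ext t
    exact ⟨fun h => h.1, fun h => ⟨h, h, rfl⟩⟩
  refine ⟨hd, hne, hB, hH, hs, hadm, ?_, ?_⟩
  · rintro y hy t ⟨hyS, ht, e⟩ hne
    have hyH : y ∈ vars H := hyS.resolve_left fun hyB =>
      Set.disjoint_left.1 hd (vars_mono hB hyB) (exVars_subset_vars R hy)
    rcases ht with ht | ht
    · obtain ⟨x, rfl, hx⟩ := h₃ y hy hyH t ht e.symm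
      exact ⟨x, rfl, ht, hx⟩
    · exact (hne (h₄ y hy hyH t ht e.symm)).elim
  · refine (forall_isAssociated_onQuery_eq_iff hadm hs).2 ⟨fun a ha => ?_, fun b hb => ?_⟩
    · obtain ⟨b, hb, e⟩ := h₁ a ha
      exact ⟨b, hb, e.imp fun i j e =>
        ⟨.inl (args_mem_terms ha i), .inr (args_mem_terms hb j), e⟩⟩
    · obtain ⟨a, ha, e⟩ := h₂ b hb
      exact ⟨a, ha, e.imp fun i j e =>
        ⟨.inl (args_mem_terms ha i), .inr (args_mem_terms hb j), e⟩⟩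

end Kernels

/-! ### From semantic matches to aggregated unifiers -/

section Core

variable {P C V : Type u} {ar : P → ℕ}

/-- The part `B` of `Q`, interpreted by `h`, is mapped into the part `H` of the head of `R`,
interpreted by `g`, in such a way that the existential variables of `R` that occur in `H` are
only identified with variables of `Q` that do not occur outside of `B`. -/
structure PieceMatch (M : Interp ar C) (Q : Query ar C V) (R : Rule ar C V) (h : V → M.D)
    (B H : Query ar C V) (g : V → M.D) : Prop where
  query_subset : B ⊆ Q
  head_subset : H ⊆ R.head
  exists_atomRel : ∀ a ∈ B, ∃ b ∈ H, AtomRel (fun t t' => M.val h t = M.val g t') a b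
  query_term : ∀ y ∈ R.exVars, y ∈ vars H → ∀ t ∈ terms B, M.val h t = g y →
    ∃ x, t = .var x ∧ x ∉ vars (Q \ B)
  head_term : ∀ y ∈ R.exVars, y ∈ vars H → ∀ t ∈ terms H, M.val g t = g y → t = .var y

/-- The variables of a query that are not identified with an existential variable. -/
def matchCutpoints {D : Type*} (R : Rule ar C V) (h : V → D) (H : Query ar C V) (g : V → D) :
    Set V :=
  {x | ∀ y ∈ R.exVars, y ∈ vars H → h x ≠ g y}

variable {M : Interp ar C} {Q : Query ar C V} {R : Rule ar C V} {h : V → M.D}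
  {B H : Query ar C V} {g : V → M.D}

theorem PieceMatch.glueClosed (hm : PieceMatch M Q R h B H g) :
    GlueClosed Q (matchCutpoints R h H g) B := by
  intro a ha a' ha' haB hs
  obtain ⟨x, ⟨hx, hx'⟩, hxT⟩ := Set.not_subset.1 hs
  simp only [matchCutpoints, Set.mem_ofPred_eq, not_forall, not_not] at hxT
  obtain ⟨y, hy, hyH, e⟩ := hxT
  by_contra hn
  have hxB := vars_mono (Finset.singleton_subset_iff.2 haB) hx
  obtain ⟨x', e', hx''⟩ := hm.query_term y hy hyH (.var x) hxB e
  cases e'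
  exact hx'' (vars_mono (Finset.singleton_subset_iff.2 (Finset.mem_sdiff.2 ⟨ha', hn⟩)) hx')

/-- A variable of `K` valued like an existential variable is not a cutpoint, so glue-closedness
draws into `K` every atom where it occurs. `H` is kept as it is, although some of its atoms may no
longer be matched. -/
theorem PieceMatch.of_glueClosed (hm : PieceMatch M Q R h B H g) {K : Query ar C V} (hK : K ⊆ B)
    (hc : GlueClosed Q (matchCutpoints R h H g) K) : PieceMatch M Q R h K H g where
  query_subset := hK.trans hm.query_subset
  head_subset := hm.head_subset
  exists_atomRel := fun a ha => hm.exists_atomRel a (hK ha)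
  query_term := by
    intro y hy hyH t ht e
    obtain ⟨x, rfl, -⟩ := hm.query_term y hy hyH t (terms_mono hK ht) e
    refine ⟨x, rfl, ?_⟩
    rintro ⟨a', ha', i', e'⟩
    obtain ⟨a, ha, i, e''⟩ := ht
    rw [Finset.mem_sdiff] at ha'
    refine ha'.2 (hc a (hm.query_subset (hK ha)) a' ha'.1 ha fun hs => ?_)
    exact hs ⟨mem_vars_singleton.2 ⟨i, e''⟩, mem_vars_singleton.2 ⟨i', e'⟩⟩ y hy hyH e
  head_term := hm.head_term

/-- A match of a piece of `Q` gives a most general single-piece unifier with a copy of the rule. -/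
theorem PieceMatch.exists_unifier (hm : PieceMatch M Q R h B H g)
    (hM : Function.Injective M.const) (hp : IsPiece Q (matchCutpoints R h H g) B)
    {f : V → V} (hf : Set.InjOn f R.vars) (hd : Disjoint (vars Q) (R.rename f).vars)
    {σ : V → M.D} (hσQ : ∀ x ∈ vars Q, σ x = h x) (hσR : ∀ x ∈ R.vars, σ (f x) = g x) :
    ∃ μ : Unifier ar C V, μ.query = B ∧ IsSinglePieceUnifier Q (R.rename f) μ ∧
      IsMostGeneral Q (R.rename f) μ ∧
      ∀ t t', μ.part.rel t t' → M.val σ t = M.val σ t' := by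
  classical
  set ρ : Subst C V := fun v => .var (f v) with hρ
  have hvQ : ∀ t ∈ terms Q, M.val σ t = M.val h t := fun t ht =>
    M.val_congr fun v e => hσQ v (var_mem_terms.1 (e ▸ ht))
  have hvR : ∀ t ∈ terms R.head, M.val σ (ρ.onTerm t) = M.val g t := fun t ht => by
    rw [M.val_onTerm]
    exact M.val_congr fun v e => hσR v (.inr (var_mem_terms.1 (e ▸ ht)))
  -- Unification requires every selected head atom to be the partner of an atom of `B`, so the
  -- unmatched ones are dropped.
  set H₀ := H.filter fun b => ∃ a ∈ B, AtomRel (fun t t' => M.val h t = M.val g t') a b with hH₀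
  have hH₀H : H₀ ⊆ H := Finset.filter_subset _ _
  have hrel : ∀ a ∈ B, ∀ b ∈ H, AtomRel (fun t t' => M.val h t = M.val g t') a b →
      AtomRel (fun t t' => M.val σ t = M.val σ t') a (ρ.onAtom b) := by
    intro a ha b hb e
    rw [AtomRel.onAtom_right]
    refine e.imp fun i j e => ?_
    rw [hvQ _ (args_mem_terms (hm.query_subset ha) i),
      hvR _ (args_mem_terms (hm.head_subset hb) j), e]
  have hker := isPieceUnifier_kernelPartition (Q := Q) (R := R.rename f) hM σ (B := B)
    (H := ρ.onQuery H₀) hd hp.prop.2.1 hm.query_subset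
    (Finset.image_subset_image (hH₀H.trans hm.head_subset))
    (fun a ha => by
      obtain ⟨b, hb, e⟩ := hm.exists_atomRel a ha
      exact ⟨ρ.onAtom b, onAtom_mem_onQuery (Finset.mem_filter.2 ⟨hb, a, ha, e⟩),
        hrel a ha b hb e⟩)
    (fun b' hb' => by
      obtain ⟨b, hb, rfl⟩ := mem_onQuery.1 hb'
      obtain ⟨hb, a, ha, e⟩ := Finset.mem_filter.1 hb
      exact ⟨a, ha, hrel a ha b hb e⟩)
    (fun y' hy' hyH t ht e => by
      rw [Rule.exVars_rename hf] at hy'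
      obtain ⟨y, hy, rfl⟩ := hy'
      rw [vars_onQuery_rename] at hyH
      obtain ⟨z, hz, e'⟩ := hyH
      have hz' := vars_mono (hH₀H.trans hm.head_subset) hz
      obtain rfl := hf (.inr hz') (exVars_subset_vars R hy) e'
      rw [hvQ t (terms_mono hm.query_subset ht), hσR z (.inr hz')] at e
      exact hm.query_term z hy (vars_mono hH₀H hz) t ht e)
    (fun y' hy' hyH t ht e => by
      rw [Rule.exVars_rename hf] at hy'
      obtain ⟨y, hy, rfl⟩ := hy'
      rw [vars_onQuery_rename] at hyH
      obtain ⟨z, hz, e'⟩ := hyH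
      have hz' := vars_mono (hH₀H.trans hm.head_subset) hz
      obtain rfl := hf (.inr hz') (exVars_subset_vars R hy) e'
      obtain ⟨t, ht₀, rfl⟩ := mem_terms_onQuery.1 ht
      have ht' := terms_mono hH₀H ht₀
      rw [hvR t (terms_mono hm.head_subset ht'), hσR z (.inr hz')] at e
      rw [hm.head_term z hy (vars_mono hH₀H hz) t ht' e]
      rfl)
  obtain ⟨ν, hq, hh, hfin, hmg⟩ := hker.exists_isMostGeneral
  refine ⟨ν, hq, ⟨hmg.1, ?_⟩, hmg, fun t t' e => (hfin t t' e).2.2⟩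
  rw [hker.cutpoints_eq_of_finer hmg.1 hq hh hfin, hq]
  refine hp.congr fun x hx => ?_
  simp only [Unifier.cutpoints, Set.mem_ofPred_eq, matchCutpoints, hx, true_and,
    Rule.exVars_rename hf, Set.forall_mem_image]
  have hxQ := vars_mono hm.query_subset hx
  refine forall_congr' fun y => forall_congr' fun hy => ?_
  have hyR := exVars_subset_vars R hy
  constructor
  · rintro hn ⟨-, hyS, e⟩
    rcases hyS with hyS | hyS
    · exact Set.disjoint_left.1 hd (vars_mono hm.query_subset hyS)
        (by rw [Rule.vars_rename]; exact ⟨y, hyR, rfl⟩)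
    · rw [var_mem_terms, vars_onQuery_rename] at hyS
      obtain ⟨z, hz, e'⟩ := hyS
      obtain rfl := hf (.inr (vars_mono (hH₀H.trans hm.head_subset) hz)) hyR e'
      refine hn (vars_mono hH₀H hz) ?_
      rw [← hσQ x hxQ, ← hσR z hyR]
      exact e
  -- Dropping head atoms loses no cutpoint condition: the head term matched with `x` has the value
  -- of `y`, hence is `y`, which therefore occurs in `H₀`.
  · intro hn hyH e
    obtain ⟨a, ha, i, hi⟩ := hx
    obtain ⟨b, hb, hab⟩ := hm.exists_atomRel a ha
    obtain ⟨j, hj⟩ := hab.exists_right i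
    rw [hi] at hj
    have hbj := hm.head_term y hy hyH _ (args_mem_terms hb j) (hj.symm.trans e)
    refine hn ⟨.inl ⟨a, ha, i, hi⟩, .inr ?_, ?_⟩
    · exact mem_terms_onQuery.2 ⟨_, args_mem_terms (Finset.mem_filter.2 ⟨hb, a, ha, hab⟩) j,
        by rw [hbj]; rfl⟩
    · change σ x = σ (f y)
      rw [hσQ x hxQ, hσR y hyR, e]

/-- Fresh disjoint copies of a finite set of variables. -/
theorem exists_fresh_renamings [Infinite V] {S W : Set V} (hS : S.Finite) (hW : W.Finite) (k : ℕ) :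
    ∃ f : Fin k → V → V, (∀ i, ∀ v ∈ W, f i v ∉ S) ∧
      ∀ i j, ∀ v ∈ W, ∀ w ∈ W, f i v = f j w → i = j ∧ v = w := by
  classical
  have := hW.to_subtype
  have := hS.infinite_compl.to_subtype
  obtain ⟨n, ⟨e⟩⟩ := Finite.exists_equiv_fin (Fin k × W)
  let F : Fin k × W ↪ ↥Sᶜ :=
    (e.toEmbedding.trans Fin.valEmbedding).trans (Infinite.natEmbedding _)
  refine ⟨fun i v => if hv : v ∈ W then F (i, ⟨v, hv⟩) else v, fun i v hv => ?_,
    fun i j v hv w hw h => ?_⟩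
  · simp only [dif_pos hv]
    exact (F (i, ⟨v, hv⟩)).2
  · simp only [dif_pos hv, dif_pos hw] at h
    simpa using F.injective (Subtype.ext h)

/-- Disjoint matches of parts of `Q` with the head of `R` give a most general single-piece
aggregated unifier, whose rewriting is satisfied as soon as the images of the body of `R` and of
the rest of `Q` are. -/
theorem exists_isMGSinglePieceFamily [Infinite V] (hM : Function.Injective M.const) {ι : Type*}
    {B H : ι → Query ar C V} {g : ι → V → M.D} (hm : ∀ j, PieceMatch M Q R h (B j) (H j) (g j))
    (hdisj : ∀ i j, i ≠ j → Disjoint (B i) (B j)) (hne : ∃ j, (B j).Nonempty)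
    (hbody : ∀ j, M.Holds (g j) R.body)
    (hrest : ∀ a ∈ Q, (∀ j, a ∉ B j) → M.pred a.pred fun i => M.val h (a.args i)) :
    ∃ (k : ℕ) (Rs : Fin k → Rule ar C V) (U : Fin k → Unifier ar C V),
      IsMGSinglePieceFamily Q R Rs U ∧ ∀ s, (aggregatedUnifier U).part.IsAssociated s →
        M.SatQuery (rewriting Q (aggregatedRule Rs) (aggregatedUnifier U) s) := by
  classical
  let T : ι → Set V := fun j => matchCutpoints R h (H j) (g j)
  -- All pieces of all the parts; there will be one copy of `R` for each, and `J` selects the part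
  -- that a piece comes from.
  let 𝓚 : Finset (Query ar C V) := Q.powerset.filter fun K => ∃ j, K ⊆ B j ∧ IsPiece Q (T j) K
  have h𝓚 : ∀ K : 𝓚, ∃ j, K.1 ⊆ B j ∧ IsPiece Q (T j) K.1 := fun K =>
    (Finset.mem_filter.1 K.2).2
  choose J hJ hpiece using h𝓚
  have hcover : ∀ j, ∀ a ∈ B j, ∃ K : 𝓚, a ∈ K.1 := fun j a ha => by
    obtain ⟨K, hK, haK, hp⟩ := (hm j).glueClosed.exists_isPiece (hm j).query_subset ha
    exact ⟨⟨K, Finset.mem_filter.2 ⟨Finset.mem_powerset.2 (hK.trans (hm j).query_subset),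
      j, hK, hp⟩⟩, haK⟩
  have hKdisj : ∀ K K' : 𝓚, K ≠ K' → Disjoint K.1 K'.1 := by
    intro K K' hKK
    by_cases hj : J K = J K'
    · by_contra hd
      exact hKK (Subtype.ext ((hpiece K).eq_of_not_disjoint (hj ▸ hpiece K') hd))
    · exact Finset.disjoint_of_subset_left (hJ K)
        (Finset.disjoint_of_subset_right (hJ K') (hdisj _ _ hj))
  let e : Fin 𝓚.card ≃ 𝓚 := 𝓚.equivFin.symm
  obtain ⟨f, hfQ, hfinj⟩ := exists_fresh_renamings (vars_finite Q) R.vars_finite 𝓚.card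
  let σ : V → M.D := fun w =>
    if hw : ∃ p : Fin 𝓚.card × V, p.2 ∈ R.vars ∧ f p.1 p.2 = w then
      g (J (e hw.choose.1)) hw.choose.2 else h w
  have hσR : ∀ i, ∀ v ∈ R.vars, σ (f i v) = g (J (e i)) v := by
    intro i v hv
    have hex : ∃ p : Fin 𝓚.card × V, p.2 ∈ R.vars ∧ f p.1 p.2 = f i v := ⟨(i, v), hv, rfl⟩
    have hsp := hex.choose_spec
    obtain ⟨h1, h2⟩ := hfinj _ _ _ hsp.1 _ hv hsp.2
    simp only [σ, dif_pos hex, h1, h2]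
  have hσQ : ∀ x ∈ vars Q, σ x = h x := by
    intro x hx
    refine dif_neg ?_
    rintro ⟨p, hp, rfl⟩
    exact hfQ _ _ hp hx
  have hf : ∀ i, Set.InjOn (f i) R.vars := fun i v hv w hw e => (hfinj i i v hv w hw e).2
  have hd : ∀ i, Disjoint (vars Q) (R.rename (f i)).vars := by
    intro i
    rw [Rule.vars_rename, Set.disjoint_right]
    rintro _ ⟨v, hv, rfl⟩
    exact hfQ i v hv
  have hU := fun i => ((hm (J (e i))).of_glueClosed (hJ (e i)) (hpiece (e i)).prop.2.2
    ).exists_unifier hM (hpiece (e i)) (hf i) (hd i) hσQ (hσR i)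
  choose U hUq hUs hUm hUσ using hU
  -- This invariance gives both admissibility of the join and the fact that applying `s` does not
  -- change values under `σ`.
  have hjoin : ∀ t t', (TermPartition.join fun i => (U i).part).rel t t' →
      M.val σ t = M.val σ t' := by
    intro t t' hr
    induction hr with
    | single hr => exact hUσ _ _ _ hr.choose_spec
    | tail _ hr ih => exact ih.trans (hUσ _ _ _ hr.choose_spec)
  refine ⟨𝓚.card, fun i => R.rename (f i), U, ⟨?_, ?_, ⟨?_, ?_, ?_, ?_⟩, hUs, hUm⟩, ?_⟩
  · obtain ⟨j, a, ha⟩ := hne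
    obtain ⟨K, -⟩ := hcover j a ha
    exact Finset.card_pos.2 ⟨K.1, K.2⟩
  · exact fun i => Rule.isCopy_iff.2 ⟨f i, hf i, rfl⟩
  · exact fun i => (hUs i).1
  · intro i j hij
    rw [Rule.vars_rename, Rule.vars_rename, Set.disjoint_left]
    rintro _ ⟨v, hv, rfl⟩ ⟨w, hw, e'⟩
    exact hij (hfinj j i w hw v hv e').1.symm
  · intro i j hij
    rw [hUq, hUq]
    exact hKdisj _ _ fun e' => hij (e.injective e')
  · exact fun c d hr => hM (hjoin _ _ hr)
  · intro s hs
    refine ⟨σ, ?_⟩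
    rw [rewriting, Interp.holds_union, Interp.holds_onQuery, Interp.holds_onQuery]
    have : (fun v => M.val σ (s v)) = σ := funext fun v => hs.apply_onTerm hjoin (.var v)
    rw [this]
    constructor
    · intro a ha
      obtain ⟨i, -, ha⟩ := Finset.mem_biUnion.1 ha
      refine Interp.holds_onQuery.2 ?_ a ha
      exact (hbody (J (e i))).congr fun v hv => (hσR i v (.inl hv)).symm
    · refine Interp.Holds.congr (α := h) (fun a ha => ?_)
        fun v hv => (hσQ v (vars_mono Finset.sdiff_subset hv)).symm
      rw [Finset.mem_sdiff] at ha
      refine hrest a ha.1 fun j haj => ha.2 ?_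
      obtain ⟨K, hK⟩ := hcover j a haj
      refine Finset.mem_biUnion.2 ⟨e.symm K, Finset.mem_univ _, ?_⟩
      rw [hUq, e.apply_symm_apply]
      exact hK

end Core

/-! ### Queries as interpretations -/

section Canonical

variable {P C V : Type u} {ar : P → ℕ}

/-- The interpretation of a query by its own atoms. -/
def canonicalInterp [Nonempty V] (A : Query ar C V) : Interp ar C where
  D := Term C V
  nonempty := ⟨.var (Classical.arbitrary V)⟩
  const := .const
  pred p x := ⟨p, x⟩ ∈ A

theorem canonicalInterp_val [Nonempty V] (A : Query ar C V) (s : Subst C V) (t : Term C V) :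
    (canonicalInterp A).val s t = s.onTerm t := by
  cases t <;> rfl

theorem canonicalInterp_holds [Nonempty V] {A B : Query ar C V} {s : Subst C V} :
    (canonicalInterp A).Holds s B ↔ s.onQuery B ⊆ A := by
  simp only [Interp.Holds, Subst.onQuery, Finset.image_subset_iff, canonicalInterp_val]
  rfl

theorem canonicalInterp_satQuery [Nonempty V] {A B : Query ar C V} :
    (canonicalInterp A).SatQuery B ↔ MoreGeneral B A :=
  exists_congr fun _ => canonicalInterp_holds

theorem onTerm_onTerm (s s' : Subst C V) (t : Term C V) :
    s'.onTerm (s.onTerm t) = Subst.onTerm (fun v => s'.onTerm (s v)) t := by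
  cases t <;> rfl

theorem onAtom_onAtom (s s' : Subst C V) (a : Atom ar C V) :
    s'.onAtom (s.onAtom a) = Subst.onAtom (fun v => s'.onTerm (s v)) a := by
  simp only [Subst.onAtom, onTerm_onTerm]

theorem onQuery_onQuery (s s' : Subst C V) (A : Query ar C V) :
    s'.onQuery (s.onQuery A) = Subst.onQuery (fun v => s'.onTerm (s v)) A := by
  simp only [Subst.onQuery, Finset.image_image]
  exact congrArg (Finset.image · A) (funext (onAtom_onAtom s s'))

theorem MoreGeneral.trans {A B D : Query ar C V} (h : MoreGeneral A B) (h' : MoreGeneral B D) :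
    MoreGeneral A D := by
  obtain ⟨s, hs⟩ := h
  obtain ⟨s', hs'⟩ := h'
  refine ⟨fun v => s'.onTerm (s v), ?_⟩
  rw [← onQuery_onQuery]
  exact (Finset.image_subset_image hs).trans hs'

/-- The rewritings obtained with two associated substitutions are equivalent. -/
theorem moreGeneral_rewriting {Q : Query ar C V} {R : Rule ar C V} {μ : Unifier ar C V}
    {s s' : Subst C V} (hs : μ.part.IsAssociated s) (hs' : μ.part.IsAssociated s') :
    MoreGeneral (rewriting Q R μ s) (rewriting Q R μ s') := by
  refine ⟨s', ?_⟩
  have : (fun v => s'.onTerm (s v)) = s' := funext fun v =>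
    hs.apply_onTerm (v := s'.onTerm) hs'.const_on_class (.var v)
  have key : ∀ A : Query ar C V, s'.onQuery (s.onQuery A) = s'.onQuery A := fun A => by
    rw [onQuery_onQuery, this]
  have hu : s'.onQuery (rewriting Q R μ s) =
      s'.onQuery (s.onQuery R.body) ∪ s'.onQuery (s.onQuery (Q \ μ.query)) :=
    Finset.image_union _ _
  rw [hu, key, key]
  rfl

end Canonical

/-! ### Covering of piece-rewritings, and prunability -/

section Covering

variable {P C V : Type u} {ar : P → ℕ} [Infinite V]

theorem IsPieceUnifier.exists_isMGSinglePieceFamily {Q : Query ar C V} {R : Rule ar C V}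
    {μ : Unifier ar C V} (h : IsPieceUnifier Q R μ) :
    ∃ (k : ℕ) (Rs : Fin k → Rule ar C V) (U : Fin k → Unifier ar C V),
      IsMGSinglePieceFamily Q R Rs U ∧
      ∀ s s' : Subst C V, (aggregatedUnifier U).part.IsAssociated s → μ.part.IsAssociated s' →
        MoreGeneral (rewriting Q (aggregatedRule Rs) (aggregatedUnifier U) s)
          (rewriting Q R μ s') := by
  obtain ⟨s₀, hs₀⟩ := h.admissible.exists_isAssociated
  have hq : ∀ t ∈ terms μ.query, t ∈ μ.part.support := fun t ht => h.support_eq ▸ .inl ht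
  have hh : ∀ t ∈ terms μ.head, t ∈ μ.part.support := fun t ht => h.support_eq ▸ .inr ht
  set A := rewriting Q R μ s₀ with hA
  have hm : PieceMatch (canonicalInterp A) Q R s₀ μ.query μ.head s₀ := by
    refine ⟨h.query_subset, h.head_subset, ?_, ?_, ?_⟩
    · intro a ha
      obtain ⟨b, hb, e⟩ := h.atomRel.1 a ha
      refine ⟨b, hb, e.imp fun i j hr => ?_⟩
      rw [canonicalInterp_val, canonicalInterp_val]
      exact hs₀.const_on_class _ _ hr
    · intro y hy hyH t ht e
      rw [canonicalInterp_val] at e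
      obtain ⟨x, rfl, -, hx⟩ := h.of_mem_query hy (terms_mono h.query_subset ht)
        (hs₀.rel_of_eq (hh (.var y) hyH) (hq t ht) e.symm)
      exact ⟨x, rfl, hx⟩
    · intro y hy hyH t ht e
      rw [canonicalInterp_val] at e
      exact h.eq_of_mem_head hy ht (hs₀.rel_of_eq (hh (.var y) hyH) (hh t ht) e.symm)
  obtain ⟨k, Rs, U, hU, hsat⟩ := ExRules.exists_isMGSinglePieceFamily (M := canonicalInterp A)
    (ι := Unit) (fun _ _ => Term.const.inj) (fun _ => hm) (fun _ _ hne => (hne rfl).elim)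
    ⟨(), h.nonempty⟩
    (fun _ => canonicalInterp_holds.2 Finset.subset_union_left)
    (fun a ha hn => canonicalInterp_holds.2 (Finset.subset_union_right (s₁ := s₀.onQuery R.body))
      a (Finset.mem_sdiff.2 ⟨ha, hn ()⟩))
  exact ⟨k, Rs, U, hU, fun s s' hs hs' =>
    (canonicalInterp_satQuery.1 (hsat s hs)).trans (moreGeneral_rewriting hs₀ hs')⟩

/-- The preimages under the homomorphism `φ` of the parts of `Q₂` erased by the unifiers are matched
with the head of `R` inside `Q₂'`. -/
theorem singlePieceAggregator_prunable : (singlePieceAggregator ar C V).Prunable := by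
  classical
  rintro 𝓡 Q₁ Q₂ Q₂' ⟨φ, hφ⟩ ⟨R, hR, k, Rs, U, hU, s, hs, e⟩ hn
  have hag := hU.compatible.isPieceUnifier_aggregatedUnifier hU.pos
  choose f hf hRs using fun i => Rule.isCopy_iff.1 (hU.copy i)
  let ρ : Fin k → Subst C V := fun i v => .var (f i v)
  have hφQ : ∀ a ∈ Q₁, φ.onAtom a ∈ Q₂ := fun a ha => hφ (onAtom_mem_onQuery ha)
  have hPU := hU.compatible.pieceUnifier
  set h : Subst C V := fun x => s.onTerm (φ x) with hh
  have hht : ∀ t, h.onTerm t = s.onTerm (φ.onTerm t) := fun t => (onTerm_onTerm φ s t).symm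
  have hha : ∀ a : Atom ar C V, h.onAtom a = s.onAtom (φ.onAtom a) := fun a =>
    (onAtom_onAtom φ s a).symm
  let g : Fin k → Subst C V := fun i v => s (f i v)
  have hgt : ∀ i t, (g i).onTerm t = s.onTerm ((ρ i).onTerm t) := fun i t =>
    (onTerm_onTerm (ρ i) s t).symm
  let B : Fin k → Query ar C V := fun i => Q₁.filter fun a => φ.onAtom a ∈ (U i).query
  let H : Fin k → Query ar C V := fun i => R.head.filter fun b => (ρ i).onAtom b ∈ (U i).head
  have hterms_B : ∀ i, ∀ t ∈ terms (B i), φ.onTerm t ∈ terms (U i).query := by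
    rintro i t ⟨a, ha, j, rfl⟩
    exact args_mem_terms (Finset.mem_filter.1 ha).2 j
  have hterms_H : ∀ i, ∀ t ∈ terms (H i), (ρ i).onTerm t ∈ terms (U i).head := by
    rintro i t ⟨a, ha, j, rfl⟩
    exact args_mem_terms (Finset.mem_filter.1 ha).2 j
  have hsupp : ∀ i, ∀ t ∈ terms (U i).query ∪ terms (U i).head,
      t ∈ (TermPartition.join fun i => (U i).part).support := by
    intro i t ht
    rw [join_support]
    exact Set.mem_iUnion.2 ⟨i, (hPU i).support_eq ▸ ht⟩
  have hex : ∀ i, ∀ y ∈ R.exVars, f i y ∈ (Rs i).exVars := fun i y hy => by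
    rw [hRs i, Rule.exVars_rename (hf i)]
    exact ⟨y, hy, rfl⟩
  -- Equality under `s` only shows membership in a class of the join; for an existential variable
  -- this is the class in `U i`.
  have hrel : ∀ i, ∀ y ∈ R.exVars, y ∈ vars (H i) → ∀ t ∈ terms (U i).query ∪ terms (U i).head,
      s.onTerm t = g i y → (U i).part.rel (.var (f i y)) t := by
    intro i y hy hyH t ht e
    refine hU.compatible.rel_of_join_rel (hex i y hy) ?_
    exact hs.rel_of_eq (hsupp i _ (.inr (hterms_H i _ hyH))) (hsupp i t ht) e.symm
  have hm : ∀ i, PieceMatch (canonicalInterp Q₂') Q₁ R h (B i) (H i) (g i) := by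
    intro i
    refine ⟨Finset.filter_subset _ _, Finset.filter_subset _ _, ?_, ?_, ?_⟩
    · intro a ha
      obtain ⟨b', hb', e⟩ := (hPU i).atomRel.1 _ (Finset.mem_filter.1 ha).2
      have hb'' := (hPU i).head_subset hb'
      rw [hRs i] at hb''
      obtain ⟨b, hb, rfl⟩ := mem_onQuery.1 hb''
      refine ⟨b, Finset.mem_filter.2 ⟨hb, hb'⟩, ?_⟩
      refine (AtomRel.onAtom_right.1 (AtomRel.onAtom_left.1 e)).imp fun l m hr => ?_
      rw [canonicalInterp_val, canonicalInterp_val, hht, hgt]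
      exact hs.const_on_class _ _ (.single ⟨i, hr⟩)
    · intro y hy hyH t ht e
      rw [canonicalInterp_val, hht] at e
      have htU := hterms_B i t ht
      obtain ⟨x', hx', -, hxn⟩ := (hPU i).of_mem_query (hex i y hy)
        (terms_mono (hPU i).query_subset htU) (hrel i y hy hyH _ (.inl htU) e)
      cases t with
      | const c => cases hx'
      | var x =>
        refine ⟨x, rfl, ?_⟩
        rintro ⟨a, ha, l, hl⟩
        rw [Finset.mem_sdiff, Finset.mem_filter, not_and] at ha
        refine hxn ⟨φ.onAtom a, Finset.mem_sdiff.2 ⟨hφQ a ha.1, ha.2 ha.1⟩, l, ?_⟩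
        rw [← hx', ← hl]
        rfl
    · intro y hy hyH t ht e
      rw [canonicalInterp_val, hgt] at e
      have htU := hterms_H i t ht
      have := (hPU i).eq_of_mem_head (hex i y hy) htU (hrel i y hy hyH _ (.inr htU) e)
      cases t with
      | const c => cases this
      | var x =>
        have hx : x ∈ R.vars := .inr (vars_mono (Finset.filter_subset _ _) ht)
        rw [hf i hx (exVars_subset_vars R hy) (Term.var.inj this)]
  have hrest : ∀ a ∈ Q₁, (∀ i, a ∉ B i) → h.onAtom a ∈ Q₂' := by
    intro a ha hB
    rw [hha, e]
    refine Finset.mem_union_right _ (onAtom_mem_onQuery (Finset.mem_sdiff.2 ⟨hφQ a ha, ?_⟩))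
    intro hmem
    obtain ⟨i, -, hi⟩ := Finset.mem_biUnion.1 hmem
    exact hB i (Finset.mem_filter.2 ⟨ha, hi⟩)
  have hdisj : ∀ i j, i ≠ j → Disjoint (B i) (B j) := fun i j hij =>
    Finset.disjoint_left.2 fun a ha ha' =>
      Finset.disjoint_left.1 (hU.compatible.disjoint_query i j hij)
        (Finset.mem_filter.1 ha).2 (Finset.mem_filter.1 ha').2
  -- The only use of `Q₁ ≱ Q₂'`: if no atom of `Q₁` were mapped to an erased one, `h` would send
  -- `Q₁` into `Q₂'`.
  have hne : ∃ i, (B i).Nonempty := by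
    by_contra hne
    refine hn ⟨h, fun b hb => ?_⟩
    obtain ⟨a, ha, rfl⟩ := mem_onQuery.1 hb
    exact hrest a ha fun i hi => hne ⟨i, a, hi⟩
  have hbody : ∀ i, (canonicalInterp Q₂').Holds (g i) R.body := by
    refine fun i => canonicalInterp_holds.2 fun b hb => ?_
    obtain ⟨a, ha, rfl⟩ := mem_onQuery.1 hb
    have hga : (g i).onAtom a = s.onAtom ((ρ i).onAtom a) := (onAtom_onAtom (ρ i) s a).symm
    rw [hga, e]
    refine Finset.mem_union_left _ (onAtom_mem_onQuery
      (Finset.mem_biUnion.2 ⟨i, Finset.mem_univ _, ?_⟩))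
    rw [hRs i]
    exact onAtom_mem_onQuery ha
  obtain ⟨k', Rs', U', hU', hsat⟩ := exists_isMGSinglePieceFamily (M := canonicalInterp Q₂')
    (fun _ _ => Term.const.inj) hm hdisj hne hbody fun a ha hB => by
      simp only [canonicalInterp_val]
      exact hrest a ha hB
  obtain ⟨s', hs'⟩ := hU'.compatible.admissible.exists_isAssociated
  exact ⟨_, ⟨R, hR, k', Rs', U', hU', s', hs', rfl⟩, canonicalInterp_satQuery.1 (hsat s' hs')⟩

end Covering

/-! ### The Skolem chase -/

section Chase

variable {P C V : Type u} {ar : P → ℕ}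

/-- The domain of the Skolem chase: constants, variables of the facts, and a null for each
existential variable of each rule and each assignment of the variables of the rule. -/
inductive SkolemTerm {P : Type u} (ar : P → ℕ) (C V : Type u) : Type u
  | const (c : C)
  | null (v : V)
  | skolem (R : Rule ar C V) (y : V) (α : V → SkolemTerm ar C V)

/-- Ground atoms over the domain of the Skolem chase. -/
abbrev SkolemAtom {P : Type u} (ar : P → ℕ) (C V : Type u) : Type u :=
  Σ p : P, Fin (ar p) → SkolemTerm ar C V

/-- The interpretation with a given set of ground atoms. -/
def skolemInterp [Nonempty V] (S : Set (SkolemAtom ar C V)) : Interp ar C where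
  D := SkolemTerm ar C V
  nonempty := ⟨.null (Classical.arbitrary V)⟩
  const := .const
  pred p x := ⟨p, x⟩ ∈ S

/-- Value of a term under an assignment. -/
def skolemVal (α : V → SkolemTerm ar C V) : Term C V → SkolemTerm ar C V
  | .var v => α v
  | .const c => .const c

theorem skolemInterp_val [Nonempty V] (S : Set (SkolemAtom ar C V)) (α : V → SkolemTerm ar C V)
    (t : Term C V) : (skolemInterp S).val α t = skolemVal α t := by
  cases t <;> rfl

/-- The ground instances of the atoms of a query. -/
def skolemAtoms (α : V → SkolemTerm ar C V) (A : Query ar C V) : Set (SkolemAtom ar C V) :=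
  {x | ∃ a ∈ A, x = ⟨a.pred, fun i => skolemVal α (a.args i)⟩}

theorem skolemInterp_holds [Nonempty V] {S : Set (SkolemAtom ar C V)}
    {α : V → SkolemTerm ar C V} {A : Query ar C V} :
    (skolemInterp S).Holds α A ↔ skolemAtoms α A ⊆ S := by
  simp only [Interp.Holds, skolemInterp_val]
  constructor
  · rintro h _ ⟨a, ha, rfl⟩
    exact h a ha
  · intro h a ha
    exact h ⟨a, ha, rfl⟩

open Classical in
/-- The extension of an assignment of the body of a rule to its existential variables. -/
noncomputable def skolemExtend (R : Rule ar C V) (α : V → SkolemTerm ar C V) :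
    V → SkolemTerm ar C V :=
  fun v => if v ∈ R.exVars then .skolem R v α else α v

/-- `ChaseStep F 𝓡 Tr S`: the set of atoms `S` is obtained from the fact `F` by applying the
triggers in `Tr`. -/
inductive ChaseStep (F : Query ar C V) (𝓡 : Set (Rule ar C V)) :
    Set (Rule ar C V × (V → SkolemTerm ar C V)) → Set (SkolemAtom ar C V) → Prop
  | start : ChaseStep F 𝓡 ∅ (skolemAtoms .null F)
  | step {Tr S} (h : ChaseStep F 𝓡 Tr S) {R α} (hR : R ∈ 𝓡) (hn : (R, α) ∉ Tr)
      (hb : skolemAtoms α R.body ⊆ S) :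
      ChaseStep F 𝓡 (insert (R, α) Tr) (S ∪ skolemAtoms (skolemExtend R α) R.head)

variable {F : Query ar C V} {𝓡 : Set (Rule ar C V)}
  {Tr Tr' : Set (Rule ar C V × (V → SkolemTerm ar C V))} {S S' : Set (SkolemAtom ar C V)}

theorem ChaseStep.start_subset (h : ChaseStep F 𝓡 Tr S) : skolemAtoms .null F ⊆ S := by
  induction h with
  | start => exact le_rfl
  | step _ _ _ _ ih => exact ih.trans Set.subset_union_left

theorem ChaseStep.head_subset (h : ChaseStep F 𝓡 Tr S) {R : Rule ar C V}
    {α : V → SkolemTerm ar C V} (hR : (R, α) ∈ Tr) :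
    skolemAtoms (skolemExtend R α) R.head ⊆ S := by
  induction h with
  | start => exact hR.elim
  | step _ _ _ _ ih =>
    rcases hR with hR | hR
    · cases hR
      exact Set.subset_union_right
    · exact (ih hR).trans Set.subset_union_left

/-- The Skolem terms that occur in the atoms come from the applied triggers. -/
theorem ChaseStep.mem_of_arg_eq (h : ChaseStep F 𝓡 Tr S) {x : SkolemAtom ar C V} (hx : x ∈ S)
    {i : Fin (ar x.1)} {R : Rule ar C V} {y : V} {α : V → SkolemTerm ar C V}
    (e : x.2 i = .skolem R y α) : (R, α) ∈ Tr := by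
  induction h generalizing x with
  | start =>
    obtain ⟨a, -, rfl⟩ := hx
    change skolemVal _ (a.args i) = _ at e
    cases hai : a.args i <;> rw [hai] at e <;> cases e
  | @step Tr S h R' α' hR hn hb ih =>
    rcases hx with hx | hx
    · exact .inr (ih hx e)
    · obtain ⟨a, ha, rfl⟩ := hx
      change skolemVal _ (a.args i) = _ at e
      cases hai : a.args i with
      | const c => rw [hai] at e; cases e
      | var v =>
        rw [hai] at e
        change skolemExtend R' α' v = _ at e
        rw [skolemExtend] at e
        split_ifs at e with hv
        · cases e
          exact .inl rfl
        · have hvb : v ∈ vars R'.body := by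
            by_contra hvb
            exact hv (mem_exVars.2 ⟨⟨a, ha, i, hai⟩, hvb⟩)
          obtain ⟨b, hb', j, hj⟩ := hvb
          refine .inr (ih (x := ⟨b.pred, fun i => skolemVal α' (b.args i)⟩) (hb ⟨b, hb', rfl⟩)
            (i := j) ?_)
          simp only [hj]
          exact e

/-- The triggers of the second derivation are replayed after the first one, skipping those already
applied, whose head instances are already present. -/
theorem ChaseStep.directed (h : ChaseStep F 𝓡 Tr S) (h' : ChaseStep F 𝓡 Tr' S') :
    ∃ Tr'' S'', ChaseStep F 𝓡 Tr'' S'' ∧ S ⊆ S'' ∧ S' ⊆ S'' := by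
  induction h' with
  | start => exact ⟨Tr, S, h, le_rfl, h.start_subset⟩
  | @step Tr' S' _ R α hR _ hb ih =>
    obtain ⟨Tr₁, S₁, h₁, hS, hS'⟩ := ih
    by_cases hm : (R, α) ∈ Tr₁
    · exact ⟨Tr₁, S₁, h₁, hS, Set.union_subset hS' (h₁.head_subset hm)⟩
    · exact ⟨_, _, h₁.step hR hm (hb.trans hS'), hS.trans Set.subset_union_left,
        Set.union_subset_union_left _ hS'⟩

theorem ChaseStep.exists_subset {A : Query ar C V} {α : V → SkolemTerm ar C V}
    (h : skolemAtoms α A ⊆ {x | ∃ Tr S, ChaseStep F 𝓡 Tr S ∧ x ∈ S}) :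
    ∃ Tr S, ChaseStep F 𝓡 Tr S ∧ skolemAtoms α A ⊆ S := by
  induction A using Finset.induction_on with
  | empty => exact ⟨_, _, .start, fun x ⟨a, ha, _⟩ => (Finset.notMem_empty a ha).elim⟩
  | insert a A _ ih =>
    obtain ⟨Tr, S, hS, hA⟩ := ih fun x ⟨b, hb, e⟩ => h ⟨b, Finset.mem_insert_of_mem hb, e⟩
    obtain ⟨Tr', S', hS', ha⟩ := h ⟨a, Finset.mem_insert_self _ _, rfl⟩
    obtain ⟨Tr₁, S₁, h₁, hSS, hSS'⟩ := hS.directed hS'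
    refine ⟨Tr₁, S₁, h₁, ?_⟩
    rintro _ ⟨b, hb, rfl⟩
    rcases Finset.mem_insert.1 hb with rfl | hb
    · exact hSS' ha
    · exact hSS (hA ⟨b, hb, rfl⟩)

/-- The Skolem chase is a universal model. -/
theorem Entails.exists_chaseStep [Nonempty V] {Q : Query ar C V} (h : Entails F 𝓡 Q) :
    ∃ Tr S, ChaseStep F 𝓡 Tr S ∧ ∃ α, skolemAtoms α Q ⊆ S := by
  classical
  obtain ⟨α, hα⟩ := h (skolemInterp {x | ∃ Tr S, ChaseStep F 𝓡 Tr S ∧ x ∈ S})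
    ⟨.null, skolemInterp_holds.2 fun x hx => ⟨_, _, .start, hx⟩⟩ (fun R hR α hα => by
      -- The union of all finite stages is a model of the rules: a body instance is finite, hence
      -- lies in one stage, where its trigger has been or can be applied.
      obtain ⟨Tr, S, hS, hb⟩ := ChaseStep.exists_subset (skolemInterp_holds.1 hα)
      refine ⟨skolemExtend R α, fun v hv => if_neg hv, skolemInterp_holds.2 fun x hx => ?_⟩
      by_cases hm : (R, α) ∈ Tr
      · exact ⟨Tr, S, hS, hS.head_subset hm hx⟩
      · exact ⟨_, _, hS.step hR hm hb, .inr hx⟩)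
  obtain ⟨Tr, S, hS, hQ⟩ := ChaseStep.exists_subset (skolemInterp_holds.1 hα)
  exact ⟨Tr, S, hS, α, hQ⟩

theorem entails_of_skolemAtoms_subset {Q : Query ar C V} {α : V → SkolemTerm ar C V}
    (h : skolemAtoms α Q ⊆ skolemAtoms .null F) : Entails F ∅ Q := by
  rintro M ⟨β, hβ⟩ -
  have := M.nonempty
  let π : SkolemTerm ar C V → M.D
    | .const c => M.const c
    | .null v => β v
    -- An irrelevant value: no Skolem term occurs in the instance of `F`.
    | .skolem _ _ _ => Classical.arbitrary M.D
  have hπ : ∀ (γ : V → SkolemTerm ar C V) (t : Term C V),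
      π (skolemVal γ t) = M.val (fun v => π (γ v)) t := by
    intro γ t
    cases t <;> rfl
  refine ⟨fun v => π (α v), fun a ha => ?_⟩
  obtain ⟨b, hb, e⟩ := h ⟨a, ha, rfl⟩
  have hab := (atomRel_of_sigma_eq e).imp (r' := fun t t' =>
    M.val (fun v => π (α v)) t = M.val β t') fun i j e => by
      rw [← hπ, e, hπ]
  exact hab.pred_iff.2 (hβ b hb)

end Chase

/-! ### Completeness by undoing the chase -/

section Completeness

variable {P C V : Type u} {ar : P → ℕ}

/-- Iteration adds steps at the end, whereas undoing the chase needs a step at the beginning. -/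
theorem RewOp.mem_saturation_of_mem {rew : RewOp ar C V} {𝓡 : Set (Rule ar C V)}
    {Q Q₁ Q' : Query ar C V} (h : Q₁ ∈ rew Q 𝓡) (h' : Q' ∈ rew.saturation Q₁ 𝓡) :
    Q' ∈ rew.saturation Q 𝓡 := by
  obtain ⟨k, hk⟩ := Set.mem_iUnion.1 h'
  refine Set.mem_iUnion.2 ⟨k + 1, ?_⟩
  induction k generalizing Q' with
  | zero =>
    obtain rfl : Q' = Q₁ := hk
    exact ⟨Q, rfl, h⟩
  | succ k ih =>
    obtain ⟨Q'', hQ'', hQ'⟩ := hk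
    exact ⟨Q'', ih (Set.mem_iUnion.2 ⟨k, hQ''⟩) hQ'', hQ'⟩

variable [Infinite V]

/-- A chase step can be undone by a rewriting step. -/
theorem ChaseStep.exists_rewriting {F Q : Query ar C V} {𝓡 : Set (Rule ar C V)}
    {Tr : Set (Rule ar C V × (V → SkolemTerm ar C V))} {S : Set (SkolemAtom ar C V)}
    (hS : ChaseStep F 𝓡 Tr S) {R : Rule ar C V} (hR : R ∈ 𝓡) {α β : V → SkolemTerm ar C V}
    (hn : (R, α) ∉ Tr) (hb : skolemAtoms α R.body ⊆ S)
    (hQ : skolemAtoms β Q ⊆ S ∪ skolemAtoms (skolemExtend R α) R.head)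
    (hQS : ¬ skolemAtoms β Q ⊆ S) :
    ∃ Q₁ ∈ singlePieceAggregator ar C V Q 𝓡, ∃ γ, skolemAtoms γ Q₁ ⊆ S := by
  classical
  let M := skolemInterp S
  let ground : Atom ar C V → SkolemAtom ar C V := fun a =>
    ⟨a.pred, fun i => skolemVal β (a.args i)⟩
  set g := skolemExtend R α with hg
  have hgex : ∀ y ∈ R.exVars, g y = .skolem R y α := fun y hy => if_pos hy
  have hgn : ∀ v, v ∉ R.exVars → g v = α v := fun v hv => if_neg hv
  -- A trigger is applied only once, so its nulls do not occur in `S`: a variable of `Q` valued by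
  -- such a null occurs only in atoms mapped outside `S`.
  have hfresh : ∀ x ∈ S, ∀ i y, x.2 i ≠ .skolem R y α := fun x hx i y e =>
    hn (hS.mem_of_arg_eq hx e)
  have hm : PieceMatch M Q R β (Q.filter fun a => ground a ∉ S) R.head g := by
    refine ⟨Finset.filter_subset _ _, le_rfl, ?_, ?_, ?_⟩
    · intro a ha
      rw [Finset.mem_filter] at ha
      obtain ⟨b, hb, e⟩ := (hQ ⟨a, ha.1, rfl⟩).resolve_left ha.2
      refine ⟨b, hb, (atomRel_of_sigma_eq e).imp fun i j e => ?_⟩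
      rw [skolemInterp_val, skolemInterp_val, e]
    · intro y hy hyH t ht e
      rw [hgex y hy, skolemInterp_val] at e
      cases t with
      | const c => cases e
      | var x =>
        refine ⟨x, rfl, ?_⟩
        rintro ⟨a, ha, i, hi⟩
        rw [Finset.mem_sdiff, Finset.mem_filter, not_and, not_not] at ha
        refine hfresh _ (ha.2 ha.1) i y ?_
        change skolemVal β (a.args i) = _
        rw [hi]
        exact e
    · intro y hy hyH t ht e
      rw [hgex y hy, skolemInterp_val] at e
      cases t with
      | const c => cases e
      | var v =>
        change g v = _ at e
        by_cases hv : v ∈ R.exVars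
        · rw [hgex v hv] at e
          cases e
          rfl
        · rw [hgn v hv] at e
          have hvb : v ∈ vars R.body := by
            by_contra hvb
            exact hv (mem_exVars.2 ⟨ht, hvb⟩)
          obtain ⟨b, hb', i, hi⟩ := hvb
          refine (hfresh _ (hb ⟨b, hb', rfl⟩) i y ?_).elim
          change skolemVal α (b.args i) = _
          rw [hi]
          exact e
  have hne : (Q.filter fun a => ground a ∉ S).Nonempty := by
    obtain ⟨_, ⟨a, ha, rfl⟩, hx⟩ := Set.not_subset.1 hQS
    exact ⟨a, Finset.mem_filter.2 ⟨ha, hx⟩⟩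
  have hbody : M.Holds g R.body :=
    Interp.Holds.congr (M := M) (skolemInterp_holds.2 hb) fun v hv =>
      (hgn v fun hex => (mem_exVars.1 hex).2 hv).symm
  have hrest : ∀ a ∈ Q, a ∉ Q.filter (fun a => ground a ∉ S) → ground a ∈ S := by
    intro a ha hB
    by_contra hx
    exact hB (Finset.mem_filter.2 ⟨ha, hx⟩)
  obtain ⟨k, Rs, U, hU, hsat⟩ := exists_isMGSinglePieceFamily (M := M) (ι := Unit)
    (fun _ _ => SkolemTerm.const.inj) (fun _ => hm) (fun _ _ hne => (hne rfl).elim)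
    ⟨(), hne⟩ (fun _ => hbody) (fun a ha hB => by
      simp only [M, skolemInterp_val]
      exact hrest a ha (hB ()))
  obtain ⟨s, hs⟩ := hU.compatible.admissible.exists_isAssociated
  obtain ⟨γ, hγ⟩ := hsat s hs
  exact ⟨_, ⟨R, hR, k, Rs, U, hU, s, hs, rfl⟩, γ, skolemInterp_holds.1 hγ⟩

theorem singlePieceAggregator_complete : (singlePieceAggregator ar C V).Complete := by
  intro 𝓡 Q F h
  obtain ⟨Tr, S, hS, hQ⟩ := h.exists_chaseStep
  -- The induction varies `Q` and only needs a match of it in the current stage, not the entailment.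
  clear h
  induction hS generalizing Q with
  | start =>
    obtain ⟨α, hα⟩ := hQ
    exact ⟨Q, Set.mem_iUnion.2 ⟨0, rfl⟩, entails_of_skolemAtoms_subset hα⟩
  | @step Tr S hS R α hR hn hb ih =>
    obtain ⟨β, hβ⟩ := hQ
    by_cases hQS : skolemAtoms β Q ⊆ S
    · exact ih Q ⟨β, hQS⟩
    · obtain ⟨Q₁, hQ₁, hγ⟩ := hS.exists_rewriting hR hn hb hβ hQS
      obtain ⟨Q', hQ', hF⟩ := ih Q₁ hγ
      exact ⟨Q', RewOp.mem_saturation_of_mem hQ₁ hQ', hF⟩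

end Completeness

end ExRules

theorem theorem7 {P C V : Type u} [Infinite V] (ar : P → ℕ) :
    -- the single-piece aggregator is sound, complete and prunable
    (ExRules.singlePieceAggregator ar C V).Sound ∧
    (ExRules.singlePieceAggregator ar C V).Complete ∧
    (ExRules.singlePieceAggregator ar C V).Prunable ∧
    -- an aggregated unifier is a piece-unifier with the aggregation of the rules
    (∀ (Q : ExRules.Query ar C V) (k : ℕ) (Rs : Fin k → ExRules.Rule ar C V)
      (U : Fin k → ExRules.Unifier ar C V), 0 < k → ExRules.Compatible Q Rs U →
      ExRules.IsPieceUnifier Q (ExRules.aggregatedRule Rs) (ExRules.aggregatedUnifier U)) ∧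
    -- every one-step piece-rewriting is covered by an aggregated rewriting
    (∀ (Q : ExRules.Query ar C V) (R : ExRules.Rule ar C V) (μ : ExRules.Unifier ar C V),
      ExRules.IsPieceUnifier Q R μ →
      ∃ (k : ℕ) (Rs : Fin k → ExRules.Rule ar C V) (U : Fin k → ExRules.Unifier ar C V),
        ExRules.IsMGSinglePieceFamily Q R Rs U ∧
        ∀ s s' : ExRules.Subst C V,
          (ExRules.aggregatedUnifier U).part.IsAssociated s → μ.part.IsAssociated s' →
          ExRules.MoreGeneral
            (ExRules.rewriting Q (ExRules.aggregatedRule Rs) (ExRules.aggregatedUnifier U) s)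
            (ExRules.rewriting Q R μ s')) := by
  exact ⟨ExRules.singlePieceAggregator_sound, ExRules.singlePieceAggregator_complete,
    ExRules.singlePieceAggregator_prunable, fun _ _ _ _ hk h =>
    h.isPieceUnifier_aggregatedUnifier hk, fun _ _ _ h => h.exists_isMGSinglePieceFamily⟩
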